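/- Let $k$ be a finite field with $q$ elements and let $\mathcal{A}$ be the category of nilpotent representations of the Jordan quiver over $k$: its objects are the pairs $(V,x)$ of a finite-dimensional $k$-vector space $V$ and a nilpotent endomorphism $x$ of $V$ (equivalently, the finite-dimensional $k[x]$-modules on which $x$ acts nilpotently), and its morphisms are the linear maps commuting with the endomorphisms. For objects $M,N,R$ let $a_M=\#\mathrm{Aut}(M)$, let $\mathbf{P}^R_{M,N}$ be the number of short exact sequences $0\to N\to R\to M\to 0$, that is, of pairs of morphisms $N\to R$, $R\to M$ forming such a sequence, and let $\langle M,N\rangle=\left(\#\mathrm{Hom}(M,N)/\#\mathrm{Ext}^1(M,N)\right)^{1/2}$. The classical Hall algebra $\mathbf{H}_{cl}$ is the complex vector space with basis the isomorphism classes $[M]$ of objects of $\mathcal{A}$, with unit $[0]$ and with the bilinear product and linear coproduct $\Delta:\mathbf{H}_{cl}\to\mathbf{H}_{cl}\otimes_{\mathbb{C}}\mathbf{H}_{cl}$ given by $$[M]\cdot[N]=\sum_R \langle M,N\rangle\,\frac{\mathbf{P}^R_{M,N}}{a_M a_N}\,[R],\qquad \Delta([R])=\sum_{M,N}\langle M,N\rangle\,\frac{\mathbf{P}^R_{M,N}}{a_R}\,[M]\otimes[N],$$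 where the sums, which have only finitely many non-zero terms, run over isomorphism classes. For $n\ge 0$ let $I_{(1^n)}=(k^n,0)$. Then: (i) $\mathbf{H}_{cl}$ is commutative and cocommutative. (ii) As an algebra, $\mathbf{H}_{cl}$ is the free commutative polynomial algebra over $\mathbb{C}$ in the generators $[I_{(1^n)}]$, $n\ge 1$; that is, there is a $\mathbb{C}$-linear bijection $\mathbb{C}[X_1,X_2,\ldots]\to\mathbf{H}_{cl}$ that preserves products and units and sends $X_n$ to $[I_{(1^n)}]$ for every $n\ge 1$. (iii) For every integer $n\ge 0$, $$\Delta([I_{(1^n)}])=\sum_{r=0}^n q^{-r(n-r)}\,[I_{(1^r)}]\otimes[I_{(1^{n-r})}].$$ -/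

import Mathlib

open scoped TensorProduct

universe u

/-- A nilpotent representation of the Jordan quiver over `k`: a finite-dimensional `k`-vector
space with a nilpotent endomorphism (equivalently, a finite-dimensional `k[x]`-module on which
`x` acts nilpotently). -/
structure NilRep (k : Type u) [Field k] where
  /-- the underlying vector space -/
  V : Type u
  [addCommGroup : AddCommGroup V]
  [module : Module k V]
  [finite : Module.Finite k V]
  /-- the nilpotent endomorphism -/
  x : V →ₗ[k] V
  nilpotent : IsNilpotent x

attribute [instance] NilRep.addCommGroup NilRep.module NilRep.finite

namespace NilRep

variable {k : Type u} [Field k]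

/-- The differential of the two-term complex
`Hom_k(V_M, V_N) → Hom_k(V_M, V_N)`, `f ↦ x_N ∘ f - f ∘ x_M`, which is obtained by applying
`Hom(-, N)` to the projective resolution `0 → k[x] ⊗ V_M → k[x] ⊗ V_M → M → 0` and whose
cohomology is `Ext^i(M, N)`. -/
def extDiff (M N : NilRep k) : (M.V →ₗ[k] N.V) →ₗ[k] (M.V →ₗ[k] N.V) where
  toFun f := N.x ∘ₗ f - f ∘ₗ M.x
  map_add' f g := by
    rw [LinearMap.comp_add, LinearMap.add_comp]; abel
  map_smul' c f := by
    rw [LinearMap.comp_smul, LinearMap.smul_comp, RingHom.id_apply, smul_sub]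

/-- Morphisms of representations: the linear maps `f` with `x_N ∘ f = f ∘ x_M`. -/
def Hom (M N : NilRep k) : Submodule k (M.V →ₗ[k] N.V) := LinearMap.ker (extDiff M N)

theorem mem_hom_iff {M N : NilRep k} {f : M.V →ₗ[k] N.V} :
    f ∈ Hom M N ↔ N.x ∘ₗ f = f ∘ₗ M.x := by
  rw [Hom, LinearMap.mem_ker]
  exact sub_eq_zero

/-- `Ext^1(M, N)`. The higher extension groups vanish, the category being hereditary. -/
abbrev Ext1 (M N : NilRep k) : Type u := (M.V →ₗ[k] N.V) ⧸ LinearMap.range (extDiff M N)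

/-- The square root of the multiplicative Euler form,
`⟨M, N⟩ = (# Hom(M, N) / # Ext^1(M, N)) ^ (1/2)`. -/
noncomputable def euler (M N : NilRep k) : ℂ :=
  ((Real.sqrt ((Nat.card (Hom M N) : ℝ) / (Nat.card (Ext1 M N) : ℝ)) : ℝ) : ℂ)

/-- Isomorphisms of representations. -/
def Iso (M N : NilRep k) : Type u := {f : M.V ≃ₗ[k] N.V // (f : M.V →ₗ[k] N.V) ∈ Hom M N}

/-- `a_M`, the number of automorphisms of `M`. -/
noncomputable def autCard (M : NilRep k) : ℕ := Nat.card (Iso M M)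

/-- The set of short exact sequences `0 → N → R → M → 0`. -/
def ShortExact (M N R : NilRep k) : Type u :=
  {p : Hom N R × Hom R M // Function.Injective p.1.1 ∧ Function.Surjective p.2.1 ∧
    Function.Exact p.1.1 p.2.1}

/-- The number of short exact sequences `0 → N → R → M → 0`. -/
noncomputable def sesCard (M N R : NilRep k) : ℕ := Nat.card (ShortExact M N R)

variable (k) in
/-- The isomorphism relation. -/
def isoSetoid : Setoid (NilRep k) where
  r M N := Nonempty (Iso M N)
  iseqv :=
    { refl := fun M => ⟨⟨LinearEquiv.refl k M.V, mem_hom_iff.2 (by ext; rfl)⟩⟩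
      symm := by
        rintro M N ⟨⟨f, hf⟩⟩
        refine ⟨⟨f.symm, mem_hom_iff.2 ?_⟩⟩
        ext v
        apply f.injective
        have h := LinearMap.congr_fun (mem_hom_iff.1 hf) (f.symm v)
        simpa using h.symm
      trans := by
        rintro M N P ⟨⟨f, hf⟩⟩ ⟨⟨g, hg⟩⟩
        refine ⟨⟨f.trans g, mem_hom_iff.2 ?_⟩⟩
        ext v
        have h := LinearMap.congr_fun (mem_hom_iff.1 hf) v
        have h' := LinearMap.congr_fun (mem_hom_iff.1 hg) (f v)
        simp only [LinearMap.comp_apply, LinearEquiv.coe_coe] at h h'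
        simp [h', h] }

variable (k) in
/-- The set of isomorphism classes of nilpotent representations. -/
def IsoClass : Type (u + 1) := Quotient (isoSetoid k)

/-- The isomorphism class of a representation. -/
def cls (M : NilRep k) : IsoClass k := Quotient.mk (isoSetoid k) M

/-- A representative of an isomorphism class. -/
noncomputable def IsoClass.rep (c : IsoClass k) : NilRep k :=
  @Quotient.out _ (isoSetoid k) c

/-- The dimension of a representation. -/
noncomputable def dim (M : NilRep k) : ℕ := Module.finrank k M.V

theorem dim_add_of_shortExact {M N R : NilRep k} (s : ShortExact M N R) :
    M.dim + N.dim = R.dim := by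
  obtain ⟨⟨a, b⟩, ha, hb, hab⟩ := s
  have h := LinearMap.finrank_range_add_finrank_ker b.1
  rw [LinearMap.range_eq_top.2 hb, finrank_top, hab.linearMap_ker_eq,
    LinearMap.finrank_range_of_inj ha] at h
  exact h

theorem dim_add_of_sesCard_ne_zero {M N R : NilRep k} (h : sesCard M N R ≠ 0) :
    M.dim + N.dim = R.dim := by
  obtain ⟨s⟩ := (Nat.card_ne_zero.1 h).1
  exact dim_add_of_shortExact s

/-- Over a finite field there are finitely many isomorphism classes of bounded dimension. -/
theorem finite_dim_le [Finite k] (n : ℕ) : {c : IsoClass k | c.rep.dim ≤ n}.Finite := by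
  classical
  let T := Σ m : Fin (n + 1), {y : (Fin m → k) →ₗ[k] (Fin m → k) // IsNilpotent y}
  have hT : Finite T := by
    have : ∀ m : ℕ, Finite ((Fin m → k) →ₗ[k] (Fin m → k)) := fun m =>
      Module.finite_of_finite k
    infer_instance
  let F : T → IsoClass k := fun t => cls ⟨Fin t.1 → k, t.2.1, t.2.2⟩
  refine (Set.finite_range F).subset ?_
  intro c hc
  have e : c.rep.V ≃ₗ[k] (Fin c.rep.dim → k) := (Module.finBasis k c.rep.V).equivFun
  have hc' : c.rep.dim < n + 1 := Nat.lt_succ_of_le hc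
  refine ⟨⟨⟨c.rep.dim, hc'⟩, ⟨e.conj c.rep.x, ?_⟩⟩, ?_⟩
  · obtain ⟨m, hm⟩ := c.rep.nilpotent
    refine ⟨m, ?_⟩
    have : (e.conj c.rep.x) ^ m = e.conj (c.rep.x ^ m) :=
      (map_pow (e.conjRingEquiv) c.rep.x m).symm
    rw [this, hm, map_zero]
  · have hrep : cls c.rep = c := @Quotient.out_eq _ (isoSetoid k) c
    conv_rhs => rw [← hrep]
    refine Quotient.sound (s := isoSetoid k) ⟨⟨e.symm, mem_hom_iff.2 ?_⟩⟩
    ext v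
    simp [LinearEquiv.conj_apply]

/-- The semisimple representation `I_{(1^n)} = S^{⊕ n} = (k^n, 0)`. -/
def semisimple (k : Type u) [Field k] (n : ℕ) : NilRep k := ⟨Fin n → k, 0, IsNilpotent.zero⟩

end NilRep

open NilRep

/-- The underlying complex vector space of the classical Hall algebra, with basis the
isomorphism classes of nilpotent representations. -/
def HallAlgebra (k : Type u) [Field k] : Type (u + 1) := NilRep.IsoClass k →₀ ℂ

namespace HallAlgebra

variable {k : Type u} [Field k]

noncomputable instance : AddCommGroup (HallAlgebra k) :=
  inferInstanceAs (AddCommGroup (NilRep.IsoClass k →₀ ℂ))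

noncomputable instance : Module ℂ (HallAlgebra k) :=
  inferInstanceAs (Module ℂ (NilRep.IsoClass k →₀ ℂ))

/-- The basis of isomorphism classes. -/
noncomputable def basis (k : Type u) [Field k] :
    Module.Basis (NilRep.IsoClass k) ℂ (HallAlgebra k) :=
  ⟨LinearEquiv.refl ℂ (NilRep.IsoClass k →₀ ℂ)⟩

/-- The element `[M]` of the Hall algebra. -/
noncomputable def of (M : NilRep k) : HallAlgebra k := basis k (cls M)

/-- The coefficient `⟨M, N⟩ P^R_{M,N} / (a_M a_N)` of `[R]` in `[M] · [N]`. -/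
noncomputable def mulCoeff (M N R : NilRep k) : ℂ :=
  euler M N * ((sesCard M N R : ℂ) / ((autCard M : ℂ) * (autCard N : ℂ)))

/-- The coefficient `⟨M, N⟩ P^R_{M,N} / a_R` of `[M] ⊗ [N]` in `Δ [R]`. -/
noncomputable def comulCoeff (M N R : NilRep k) : ℂ :=
  euler M N * ((sesCard M N R : ℂ) / (autCard R : ℂ))

variable [Finite k]

theorem mulCoeff_support (c d : NilRep.IsoClass k) :
    (Function.support fun r : NilRep.IsoClass k => mulCoeff c.rep d.rep r.rep).Finite := by
  refine (finite_dim_le (c.rep.dim + d.rep.dim)).subset ?_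
  intro r hr
  have h : sesCard c.rep d.rep r.rep ≠ 0 := by
    intro h0
    exact hr (by simp [mulCoeff, h0])
  exact (dim_add_of_sesCard_ne_zero h).ge

theorem comulCoeff_support (r : NilRep.IsoClass k) :
    (Function.support fun p : NilRep.IsoClass k × NilRep.IsoClass k =>
      comulCoeff p.1.rep p.2.rep r.rep).Finite := by
  refine ((finite_dim_le r.rep.dim).prod (finite_dim_le r.rep.dim)).subset ?_
  intro p hp
  have h : sesCard p.1.rep p.2.rep r.rep ≠ 0 := by
    intro h0
    exact hp (by simp [comulCoeff, h0])
  have h' := dim_add_of_sesCard_ne_zero h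
  exact ⟨by simp only [Set.mem_ofPred_eq]; omega, by simp only [Set.mem_ofPred_eq]; omega⟩

/-- The multiplication, `[M] · [N] = ∑_R ⟨M, N⟩ P^R_{M,N} / (a_M a_N) [R]`. -/
noncomputable def mulMap : HallAlgebra k →ₗ[ℂ] HallAlgebra k →ₗ[ℂ] HallAlgebra k :=
  (basis k).constr ℂ fun c => (basis k).constr ℂ fun d =>
    (Finsupp.ofSupportFinite _ (mulCoeff_support c d)).sum fun r a => a • basis k r

noncomputable instance : Mul (HallAlgebra k) := ⟨fun f g => mulMap f g⟩

/-- The unit is `[0]`, the class of the zero representation. -/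
noncomputable instance : One (HallAlgebra k) := ⟨of (semisimple k 0)⟩

/-- The comultiplication, `Δ [R] = ∑_{M,N} ⟨M, N⟩ P^R_{M,N} / a_R [M] ⊗ [N]`. -/
noncomputable def comul : HallAlgebra k →ₗ[ℂ] HallAlgebra k ⊗[ℂ] HallAlgebra k :=
  (basis k).constr ℂ fun r =>
    (Finsupp.ofSupportFinite _ (comulCoeff_support r)).sum
      fun p a => a • (basis k p.1 ⊗ₜ[ℂ] basis k p.2)

end HallAlgebra

/-! The Euler form is trivial, since Hom and Ext^1 are the kernel and cokernel of one endomorphism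
of a finite-dimensional space. A short exact sequence is a subrepresentation `W` of `R` with
identifications of `W` with `N` and of `R/W` with `M`, so the structure constants count
subrepresentations and the product is the convolution `(f * g)(R) = ∑_W f(R/W) g(W)` (`coeff_mul`).

Commutativity comes from duality: `R` is isomorphic to its dual (`cls_dual`), and annihilators
exchange sub and quotient. In place of Jordan form, the structural input is that `R` is determined
by its dimension and by `R / ker x` (`cls_eq_of_quot_socle`). Cocommutativity follows because the
two kinds of coefficients differ by a factor symmetric in `M` and `N`.

For polynomiality, `[R / ker x] · [ker x]` is `[R]` plus classes of the same dimension with strictly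
larger socle; hence the `[I_(1^n)]` generate, dimension matching weight (`of_mem_map_weightLE`).
Every exponent vector is the socle type of some representation (`exists_socleType_eq`), so there are
at most as many monomials of weight `≤ n` as classes of dimension `≤ n`, and a dimension count gives
injectivity.

For the coproduct, subs and quotients of `(k^n, 0)` also have `x = 0`, and exact sequences `0 → k^m
→ k^(m+r) → k^r → 0`, each weighted by `q^(rm)`, count `GL_(m+r)(k)`. -/

namespace NilRep

variable {k : Type u} [Field k]

/-! ### Subrepresentations and the count of short exact sequences -/

theorem hom_apply {M N : NilRep k} {f : M.V →ₗ[k] N.V} (hf : f ∈ Hom M N) (v : M.V) :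
    N.x (f v) = f (M.x v) :=
  LinearMap.congr_fun (mem_hom_iff.1 hf) v

theorem mem_hom_of_apply {M N : NilRep k} {f : M.V →ₗ[k] N.V}
    (h : ∀ v, N.x (f v) = f (M.x v)) : f ∈ Hom M N :=
  mem_hom_iff.2 (LinearMap.ext h)

/-- The inverse of an isomorphism. -/
def Iso.symm {M N : NilRep k} (e : Iso M N) : Iso N M :=
  ⟨e.1.symm, mem_hom_of_apply fun v => e.1.injective <| by
    simpa using (hom_apply e.2 (e.1.symm v)).symm⟩

/-- The composition of isomorphisms. -/
def Iso.trans {M N P : NilRep k} (e : Iso M N) (f : Iso N P) : Iso M P :=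
  ⟨e.1.trans f.1, mem_hom_of_apply fun v =>
    (hom_apply f.2 (e.1 v)).trans (congrArg f.1 (hom_apply e.2 v))⟩

theorem cls_eq_iff {M N : NilRep k} : cls M = cls N ↔ Nonempty (Iso M N) :=
  ⟨fun h => Quotient.exact (s := isoSetoid k) h, fun h => Quotient.sound (s := isoSetoid k) h⟩

theorem Iso.cls_eq {M N : NilRep k} (e : Iso M N) : cls M = cls N := cls_eq_iff.2 ⟨e⟩

theorem cls_rep (c : IsoClass k) : cls c.rep = c := @Quotient.out_eq _ (isoSetoid k) c

theorem Iso.dim_eq {M N : NilRep k} (e : Iso M N) : M.dim = N.dim := e.1.finrank_eq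

theorem dim_eq_of_cls_eq {M N : NilRep k} (h : cls M = cls N) : M.dim = N.dim := by
  obtain ⟨e⟩ := cls_eq_iff.1 h
  exact e.dim_eq

theorem dim_rep_cls (M : NilRep k) : (cls M).rep.dim = M.dim :=
  dim_eq_of_cls_eq (cls_rep _)

/-- The subrepresentations of a representation. -/
def Sub (R : NilRep k) : Type u := {W : Submodule k R.V // ∀ v ∈ W, R.x v ∈ W}

/-- A subrepresentation as a representation. -/
def Sub.sub {R : NilRep k} (W : Sub R) : NilRep k where
  V := W.1
  x := R.x.restrict W.2
  nilpotent := by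
    obtain ⟨n, hn⟩ := R.nilpotent
    refine ⟨n, ?_⟩
    rw [Module.End.pow_restrict n]
    ext v
    simp [hn]

/-- The quotient by a subrepresentation. -/
def Sub.quot {R : NilRep k} (W : Sub R) : NilRep k where
  V := R.V ⧸ W.1
  x := W.1.mapQ W.1 R.x W.2
  nilpotent := by
    obtain ⟨n, hn⟩ := R.nilpotent
    refine ⟨n, ?_⟩
    rw [← Submodule.mapQ_pow]
    simp only [hn]
    ext v
    simp

/-- The inclusion of a subrepresentation. -/
def Sub.incl {R : NilRep k} (W : Sub R) : W.sub.V →ₗ[k] R.V := W.1.subtype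

/-- The projection to the quotient. -/
def Sub.proj {R : NilRep k} (W : Sub R) : R.V →ₗ[k] W.quot.V := W.1.mkQ

theorem Sub.incl_mem {R : NilRep k} (W : Sub R) : W.incl ∈ Hom W.sub R :=
  mem_hom_of_apply fun _ => rfl

theorem Sub.proj_mem {R : NilRep k} (W : Sub R) : W.proj ∈ Hom R W.quot :=
  mem_hom_of_apply fun _ => rfl

theorem Sub.incl_injective {R : NilRep k} (W : Sub R) : Function.Injective W.incl :=
  W.1.injective_subtype

theorem Sub.proj_surjective {R : NilRep k} (W : Sub R) : Function.Surjective W.proj :=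
  W.1.mkQ_surjective

theorem Sub.range_incl {R : NilRep k} (W : Sub R) : LinearMap.range W.incl = W.1 :=
  W.1.range_subtype

theorem Sub.ker_proj {R : NilRep k} (W : Sub R) : LinearMap.ker W.proj = W.1 :=
  W.1.ker_mkQ

theorem comp_mem_hom {M N P : NilRep k} {f : M.V →ₗ[k] N.V} {g : N.V →ₗ[k] P.V}
    (hf : f ∈ Hom M N) (hg : g ∈ Hom N P) : g ∘ₗ f ∈ Hom M P :=
  mem_hom_of_apply fun v => (hom_apply hg (f v)).trans (congrArg g (hom_apply hf v))

/-- A subrepresentation is isomorphic to the source of any injection with that range. -/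
noncomputable def Sub.subIso {N R : NilRep k} (W : Sub R) {i : N.V →ₗ[k] R.V} (hi : i ∈ Hom N R)
    (inj : Function.Injective i) (hr : LinearMap.range i = W.1) : Iso N W.sub :=
  ⟨(LinearEquiv.ofInjective i inj).trans (LinearEquiv.ofEq _ _ hr),
    mem_hom_of_apply fun v => Subtype.ext (hom_apply hi v)⟩

/-- A quotient is isomorphic to the target of any surjection with the right kernel. -/
noncomputable def Sub.quotIso {M R : NilRep k} (W : Sub R) {p : R.V →ₗ[k] M.V} (hp : p ∈ Hom R M)
    (surj : Function.Surjective p) (hk : LinearMap.ker p = W.1) : Iso W.quot M :=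
  ⟨(Submodule.quotEquivOfEq _ _ hk.symm).trans (p.quotKerEquivOfSurjective surj),
    mem_hom_of_apply fun v => by
      obtain ⟨v, rfl⟩ := W.proj_surjective v
      exact hom_apply hp v⟩

/-- The subrepresentation cut out by the range of a morphism. -/
def rangeSub {N R : NilRep k} {i : N.V →ₗ[k] R.V} (hi : i ∈ Hom N R) : Sub R :=
  ⟨LinearMap.range i, by
    rintro _ ⟨v, rfl⟩
    exact ⟨N.x v, (hom_apply hi v).symm⟩⟩

/-- The subrepresentation cut out by the kernel of a morphism. -/
def kerSub {M R : NilRep k} {p : R.V →ₗ[k] M.V} (hp : p ∈ Hom R M) : Sub R :=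
  ⟨LinearMap.ker p, fun v hv => by
    rw [LinearMap.mem_ker] at hv ⊢
    rw [← hom_apply hp, hv, map_zero]⟩

theorem Sub.dim_add {R : NilRep k} (W : Sub R) : W.quot.dim + W.sub.dim = R.dim :=
  W.1.finrank_quotient_add_finrank

/-- Short exact sequences are subrepresentations with identifications of the subobject and the
quotient. -/
noncomputable def shortExactEquiv (M N R : NilRep k) :
    (Σ W : Sub R, Iso N W.sub × Iso W.quot M) ≃ ShortExact M N R :=
  Equiv.ofBijective
    (fun s => ⟨(⟨s.1.incl ∘ₗ s.2.1.1.toLinearMap, comp_mem_hom s.2.1.2 s.1.incl_mem⟩,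
        ⟨s.2.2.1.toLinearMap ∘ₗ s.1.proj, comp_mem_hom s.1.proj_mem s.2.2.2⟩),
      s.1.incl_injective.comp s.2.1.1.injective, s.2.2.1.surjective.comp s.1.proj_surjective, by
        rw [LinearMap.exact_iff, LinearEquiv.ker_comp, LinearMap.range_comp,
          LinearEquiv.range, Submodule.map_top, s.1.range_incl, s.1.ker_proj]⟩) <| by
    constructor
    · rintro ⟨W, i, p⟩ ⟨W', i', p'⟩ h
      have h1 : W.incl ∘ₗ i.1.toLinearMap = W'.incl ∘ₗ i'.1.toLinearMap :=
        congrArg (fun t => t.1.1.1) h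
      have h2 : p.1.toLinearMap ∘ₗ W.proj = p'.1.toLinearMap ∘ₗ W'.proj :=
        congrArg (fun t => t.1.2.1) h
      -- `W` is recovered as the range of the first map.
      have hW : W = W' := by
        apply Subtype.ext
        have := congrArg LinearMap.range h1
        rwa [LinearMap.range_comp, LinearMap.range_comp, LinearEquiv.range, LinearEquiv.range,
          Submodule.map_top, Submodule.map_top, W.range_incl, W'.range_incl] at this
      subst hW
      have hi : i = i' := Subtype.ext <| LinearEquiv.ext fun v =>
        W.incl_injective (LinearMap.congr_fun h1 v)
      have hp : p = p' := Subtype.ext <| LinearEquiv.ext fun v => by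
        obtain ⟨v, rfl⟩ := W.proj_surjective v
        exact LinearMap.congr_fun h2 v
      rw [hi, hp]
    · rintro ⟨⟨⟨a, ha⟩, ⟨b, hb⟩⟩, inj, surj, ex⟩
      exact ⟨⟨rangeSub ha, (rangeSub ha).subIso ha inj rfl,
        (rangeSub ha).quotIso hb surj ex.linearMap_ker_eq⟩, rfl⟩

theorem card_iso_left {M N : NilRep k} (e : Iso M N) : Nat.card (Iso M N) = autCard M :=
  Nat.card_congr
    { toFun := fun f => f.trans e.symm
      invFun := fun f => f.trans e
      left_inv := fun _ => Subtype.ext <| LinearEquiv.ext fun _ => e.1.apply_symm_apply _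
      right_inv := fun _ => Subtype.ext <| LinearEquiv.ext fun _ => e.1.symm_apply_apply _ }

theorem card_iso_right {M N : NilRep k} (e : Iso M N) : Nat.card (Iso M N) = autCard N :=
  Nat.card_congr
    { toFun := fun f => e.symm.trans f
      invFun := fun f => e.trans f
      left_inv := fun f => Subtype.ext <| LinearEquiv.ext fun _ =>
        congrArg f.1 (e.1.symm_apply_apply _)
      right_inv := fun f => Subtype.ext <| LinearEquiv.ext fun _ =>
        congrArg f.1 (e.1.apply_symm_apply _) }

open Classical in
theorem card_iso_eq_left (M N : NilRep k) :
    Nat.card (Iso M N) = if cls M = cls N then autCard M else 0 := by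
  split_ifs with h
  · obtain ⟨e⟩ := cls_eq_iff.1 h
    exact card_iso_left e
  · have : IsEmpty (Iso M N) := ⟨fun e => h e.cls_eq⟩
    exact Nat.card_of_isEmpty

open Classical in
theorem card_iso_eq_right (M N : NilRep k) :
    Nat.card (Iso M N) = if cls M = cls N then autCard N else 0 := by
  split_ifs with h
  · obtain ⟨e⟩ := cls_eq_iff.1 h
    exact card_iso_right e
  · have : IsEmpty (Iso M N) := ⟨fun e => h e.cls_eq⟩
    exact Nat.card_of_isEmpty

/-- The product is defined through chosen representatives of classes; this removes the dependence on
the choice for the middle term. -/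
theorem sesCard_congr (M N : NilRep k) {R R' : NilRep k} (e : Iso R R') :
    sesCard M N R = sesCard M N R' := by
  have exact_comp : ∀ {R R' : NilRep k} (e : Iso R R') {a : N.V →ₗ[k] R.V} {b : R.V →ₗ[k] M.V},
      Function.Exact a b →
        Function.Exact (e.1.toLinearMap ∘ₗ a) (b ∘ₗ e.symm.1.toLinearMap) := by
    intro R R' e a b h y
    constructor
    · intro hy
      obtain ⟨z, hz⟩ := (h (e.symm.1 y)).1 hy
      exact ⟨z, (congrArg e.1 hz).trans (e.1.apply_symm_apply y)⟩
    · rintro ⟨z, rfl⟩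
      exact (congrArg b (e.1.symm_apply_apply _)).trans ((h _).2 ⟨z, rfl⟩)
  let F : ∀ {R R' : NilRep k}, Iso R R' → ShortExact M N R → ShortExact M N R' :=
    fun e s => ⟨(⟨e.1.toLinearMap ∘ₗ s.1.1.1, comp_mem_hom s.1.1.2 e.2⟩,
      ⟨s.1.2.1 ∘ₗ e.symm.1.toLinearMap, comp_mem_hom e.symm.2 s.1.2.2⟩),
      e.1.injective.comp s.2.1, s.2.2.1.comp e.symm.1.surjective, exact_comp e s.2.2.2⟩
  have hF : ∀ {R R' : NilRep k} (e : Iso R R') (s : ShortExact M N R), F e.symm (F e s) = s := by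
    intro R R' e s
    apply Subtype.ext
    apply Prod.ext
    · exact Subtype.ext (LinearMap.ext fun _ => e.1.symm_apply_apply _)
    · exact Subtype.ext (LinearMap.ext fun _ => congrArg s.1.2.1 (e.1.symm_apply_apply _))
  exact Nat.card_congr ⟨F e, F e.symm, hF e, hF e.symm⟩

variable [Finite k]

instance finite_V (M : NilRep k) : Finite M.V := Module.finite_of_finite k

instance finite_linearMap (M N : NilRep k) : Finite (M.V →ₗ[k] N.V) := Module.finite_of_finite k

instance finite_iso (M N : NilRep k) : Finite (Iso M N) :=
  Finite.of_injective (fun e => (e.1 : M.V →ₗ[k] N.V)) fun _ _ h =>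
    Subtype.ext (LinearEquiv.toLinearMap_injective h)

instance finite_sub (R : NilRep k) : Finite (Sub R) := by
  have : Finite (Submodule k R.V) := Finite.of_injective _ SetLike.coe_injective
  exact Subtype.finite

noncomputable instance (R : NilRep k) : Fintype (Sub R) := Fintype.ofFinite _

theorem autCard_ne_zero (M : NilRep k) : autCard M ≠ 0 := by
  have : Nonempty (Iso M M) := cls_eq_iff.1 rfl
  exact Nat.card_pos.ne'

/-- The Euler form of the Jordan quiver vanishes. -/
theorem euler_eq_one (M N : NilRep k) : euler M N = 1 := by
  -- Rank-nullity and the quotient formula involve the same range, so kernel and cokernel have equal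
  -- dimension.
  have h1 := (extDiff M N).finrank_range_add_finrank_ker
  have h2 := (LinearMap.range (extDiff M N)).finrank_quotient_add_finrank
  have h3 : Nat.card (Hom M N) = Nat.card (Ext1 M N) := by
    rw [Module.natCard_eq_pow_finrank (K := k),
      Module.natCard_eq_pow_finrank (K := k) (V := Ext1 M N)]
    congr 1
    unfold Hom Ext1
    omega
  have h4 : (Nat.card (Hom M N) : ℝ) ≠ 0 := Nat.cast_ne_zero.2 Nat.card_pos.ne'
  rw [euler, ← h3, div_self h4, Real.sqrt_one, Complex.ofReal_one]

-- A `W` of the right type and cotype carries `a_M a_N` pairs of identifications, any other `W`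
-- none.
open Classical in
theorem sesCard_eq (M N R : NilRep k) :
    (sesCard M N R : ℂ) = autCard M * autCard N *
      ∑ W : Sub R, (if cls W.quot = cls M then 1 else 0) * (if cls W.sub = cls N then 1 else 0) := by
  rw [sesCard, ← Nat.card_congr (shortExactEquiv M N R), Nat.card_sigma, Nat.cast_sum,
    Finset.mul_sum]
  refine Finset.sum_congr rfl fun W _ => ?_
  rw [Nat.card_prod, card_iso_eq_left, card_iso_eq_right]
  by_cases h1 : cls W.quot = cls M <;> by_cases h2 : cls W.sub = cls N <;>
    simp [h1, h2, eq_comm (a := cls N), mul_comm]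

end NilRep

/-! ### The product as a convolution -/

namespace HallAlgebra
open NilRep
variable {k : Type u} [Field k]

/-- The coefficient of `[M]`. -/
noncomputable def coeff (M : NilRep k) : HallAlgebra k →ₗ[ℂ] ℂ := (basis k).coord (cls M)

theorem coeff_congr {M N : NilRep k} (h : cls M = cls N) (f : HallAlgebra k) :
    coeff M f = coeff N f := by rw [coeff, h]; rfl

theorem ext_coeff {f g : HallAlgebra k} (h : ∀ M : NilRep k, coeff M f = coeff M g) : f = g := by
  refine (basis k).ext_elem fun c => ?_
  have := h c.rep
  rwa [coeff, cls_rep] at this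

open Classical in
theorem coeff_of (M N : NilRep k) : coeff M (of N) = if cls M = cls N then 1 else 0 := by
  rw [coeff, of, Module.Basis.coord_apply, Module.Basis.repr_self, Finsupp.single_apply]
  simp only [eq_comm]

theorem basis_eq_of (c : IsoClass k) : basis k c = of c.rep := by rw [of, cls_rep]

variable [Finite k]

open Classical in
theorem mulCoeff_eq (M N R : NilRep k) : mulCoeff M N R =
    ∑ W : Sub R, (if cls W.quot = cls M then 1 else 0) * (if cls W.sub = cls N then 1 else 0) := by
  have hM : (autCard M : ℂ) ≠ 0 := Nat.cast_ne_zero.2 (autCard_ne_zero M)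
  have hN : (autCard N : ℂ) ≠ 0 := Nat.cast_ne_zero.2 (autCard_ne_zero N)
  rw [mulCoeff, euler_eq_one, one_mul, sesCard_eq, mul_div_cancel_left₀ _ (mul_ne_zero hM hN)]

theorem coeff_basis_mul_basis (c d : IsoClass k) (r : IsoClass k) :
    (basis k).coord r (mulMap (basis k c) (basis k d)) = mulCoeff c.rep d.rep r.rep := by
  rw [mulMap, Module.Basis.constr_basis, Module.Basis.constr_basis, Finsupp.sum, map_sum]
  classical
  simp only [map_smul, Module.Basis.coord_apply, Module.Basis.repr_self, smul_eq_mul]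
  rw [Finset.sum_eq_single r, Finsupp.single_eq_same, mul_one]
  · rfl
  · intro b _ hb
    rw [Finsupp.single_eq_of_ne hb.symm, mul_zero]
  · intro h
    rw [Finsupp.notMem_support_iff.1 h, zero_mul]

/-- The product of the Hall algebra is the convolution over subrepresentations. -/
theorem coeff_mul (f g : HallAlgebra k) (R : NilRep k) :
    coeff R (f * g) = ∑ W : Sub R, coeff W.quot f * coeff W.sub g := by
  let B : HallAlgebra k →ₗ[ℂ] HallAlgebra k →ₗ[ℂ] ℂ :=
    ∑ W : Sub R, (LinearMap.mul ℂ ℂ).compl₁₂ (coeff W.quot) (coeff W.sub)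
  have key : mulMap.compr₂ (coeff R) = B := by
    classical
    refine (basis k).ext fun c => (basis k).ext fun d => ?_
    obtain ⟨e⟩ := cls_eq_iff.1 (cls_rep (cls R))
    have h : (mulMap.compr₂ (coeff R)) (basis k c) (basis k d)
        = mulCoeff c.rep d.rep (cls R).rep := coeff_basis_mul_basis c d (cls R)
    have h' : mulCoeff c.rep d.rep (cls R).rep = mulCoeff c.rep d.rep R := by
      rw [mulCoeff, mulCoeff, sesCard_congr _ _ e]
    rw [h, h', mulCoeff_eq]
    simp only [B, LinearMap.sum_apply, LinearMap.compl₁₂_apply, LinearMap.mul_apply', basis_eq_of,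
      coeff_of]
  refine (LinearMap.congr_fun₂ key f g).trans ?_
  simp [B]

end HallAlgebra
-- Flags, unit and associativity
namespace NilRep

variable {k : Type u} [Field k]

theorem cls_quot_eq {M R : NilRep k} (W : Sub R) {p : R.V →ₗ[k] M.V} (hp : p ∈ Hom R M)
    (surj : Function.Surjective p) (hk : LinearMap.ker p = W.1) : cls W.quot = cls M :=
  (W.quotIso hp surj hk).cls_eq

theorem cls_sub_eq {N R : NilRep k} (W : Sub R) {i : N.V →ₗ[k] R.V} (hi : i ∈ Hom N R)
    (inj : Function.Injective i) (hr : LinearMap.range i = W.1) : cls W.sub = cls N :=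
  (W.subIso hi inj hr).cls_eq.symm

theorem cls_eq_of_dim_eq_zero {M N : NilRep k} (hM : M.dim = 0) (hN : N.dim = 0) :
    cls M = cls N := by
  have := Module.finrank_zero_iff.1 hM
  have := Module.finrank_zero_iff.1 hN
  exact Iso.cls_eq ⟨LinearEquiv.ofFinrankEq _ _ (hM.trans hN.symm),
    mem_hom_of_apply fun v => Subsingleton.elim _ _⟩

theorem dim_semisimple (n : ℕ) : (semisimple k n).dim = n := Module.finrank_fin_fun k

/-- The whole representation. -/
def topSub (R : NilRep k) : Sub R := ⟨⊤, fun _ _ => trivial⟩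

/-- The zero subrepresentation. -/
def botSub (R : NilRep k) : Sub R := ⟨⊥, fun v hv => by
  rw [Submodule.mem_bot] at hv ⊢
  rw [hv, map_zero]⟩

theorem Sub.eq_top_iff {R : NilRep k} (W : Sub R) : W = topSub R ↔ W.quot.dim = 0 := by
  have h := W.dim_add
  constructor
  · rintro rfl
    have : (topSub R).sub.dim = R.dim := finrank_top k R.V
    omega
  · intro h0
    exact Subtype.ext (Submodule.eq_top_of_finrank_eq (show W.sub.dim = R.dim by omega))

theorem Sub.eq_bot_iff {R : NilRep k} (W : Sub R) : W = botSub R ↔ W.sub.dim = 0 := by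
  constructor
  · rintro rfl
    exact finrank_bot k R.V
  · intro h0
    exact Subtype.ext (Submodule.finrank_eq_zero.1 h0)

theorem cls_topSub_sub (R : NilRep k) : cls (topSub R).sub = cls R :=
  cls_sub_eq _ (i := LinearMap.id) (mem_hom_of_apply fun _ => rfl) Function.injective_id
    LinearMap.range_id

theorem cls_botSub_quot (R : NilRep k) : cls (botSub R).quot = cls R :=
  cls_quot_eq _ (p := LinearMap.id) (mem_hom_of_apply fun _ => rfl) Function.surjective_id
    LinearMap.ker_id

/-- Subrepresentations of a quotient. -/
def Sub.quotSubEquiv {R : NilRep k} (A : Sub R) : Sub A.quot ≃ {B : Sub R // A.1 ≤ B.1} where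
  toFun Z := ⟨⟨Z.1.comap A.proj, fun v hv => Z.2 _ hv⟩, fun v hv => by
    have : A.proj v = 0 := (Submodule.Quotient.mk_eq_zero _).2 hv
    rw [Submodule.mem_comap, this]
    exact Z.1.zero_mem⟩
  invFun B := ⟨B.1.1.map A.proj, by
    rintro _ ⟨v, hv, rfl⟩
    exact ⟨R.x v, B.1.2 v hv, rfl⟩⟩
  left_inv Z := Subtype.ext (Submodule.map_comap_eq_of_surjective A.proj_surjective _)
  right_inv B := Subtype.ext <| Subtype.ext <| by
    change (B.1.1.map A.proj).comap A.proj = B.1.1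
    rw [Submodule.comap_map_eq, A.ker_proj, sup_eq_left]
    exact B.2

/-- Subrepresentations of a subrepresentation. -/
def Sub.subSubEquiv {R : NilRep k} (B : Sub R) : Sub B.sub ≃ {A : Sub R // A.1 ≤ B.1} where
  toFun Z := ⟨⟨Z.1.map B.incl, by
    rintro _ ⟨v, hv, rfl⟩
    exact ⟨B.sub.x v, Z.2 v hv, rfl⟩⟩, by
    rintro _ ⟨v, _, rfl⟩
    exact v.2⟩
  invFun A := ⟨A.1.1.comap B.incl, fun v hv => A.1.2 _ hv⟩
  left_inv Z := Subtype.ext (Submodule.comap_map_eq_of_injective B.incl_injective _)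
  right_inv A := Subtype.ext <| Subtype.ext <| by
    change (A.1.1.comap B.incl).map B.incl = A.1.1
    rw [Submodule.map_comap_eq, B.range_incl, inf_eq_right]
    exact A.2

theorem cls_quot_quot {R : NilRep k} (A : Sub R) (Z : Sub A.quot) :
    cls Z.quot = cls (A.quotSubEquiv Z).1.quot :=
  (cls_quot_eq _ (comp_mem_hom A.proj_mem Z.proj_mem)
    (Z.proj_surjective.comp A.proj_surjective) <| by
    rw [LinearMap.ker_comp, Z.ker_proj]; rfl).symm

theorem cls_sub_sub {R : NilRep k} (B : Sub R) (Z : Sub B.sub) :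
    cls Z.sub = cls (B.subSubEquiv Z).1.sub :=
  (cls_sub_eq _ (comp_mem_hom Z.incl_mem B.incl_mem) (B.incl_injective.comp Z.incl_injective) <| by
    rw [LinearMap.range_comp, Z.range_incl]; rfl).symm

/-- Both are `B/A`: the composite `B → R → R/A` has kernel `A` and image the left-hand subobject. -/
theorem cls_quot_sub_eq_sub_quot {R : NilRep k} (A B : Sub R) (h : A.1 ≤ B.1) :
    cls (A.quotSubEquiv.symm ⟨B, h⟩).sub = cls (B.subSubEquiv.symm ⟨A, h⟩).quot := by
  set Z := A.quotSubEquiv.symm ⟨B, h⟩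
  set Y := B.subSubEquiv.symm ⟨A, h⟩
  have hZ : ∀ v : B.sub.V, (A.proj ∘ₗ B.incl) v ∈ Z.1 := fun v => ⟨v.1, v.2, rfl⟩
  refine (cls_quot_eq Y (p := (A.proj ∘ₗ B.incl).codRestrict Z.1 hZ)
    (mem_hom_of_apply fun v => rfl) ?_ ?_).symm
  · rintro ⟨_, v, hv, rfl⟩
    exact ⟨⟨v, hv⟩, rfl⟩
  · exact (LinearMap.ker_codRestrict Z.1 (A.proj ∘ₗ B.incl) hZ).trans <| by
      rw [LinearMap.ker_comp, A.ker_proj]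
      rfl

/-- Flags `A ≤ B` of subrepresentations as subrepresentations of quotients and as
subrepresentations of subrepresentations. -/
def flagEquiv (R : NilRep k) : (Σ A : Sub R, Sub A.quot) ≃ Σ B : Sub R, Sub B.sub :=
  (Equiv.sigmaCongrRight fun A : Sub R => A.quotSubEquiv).trans <|
    Equiv.trans
      ⟨fun p => ⟨p.2.1, p.1, p.2.2⟩, fun p => ⟨p.2.1, p.1, p.2.2⟩, fun _ => rfl, fun _ => rfl⟩
      (Equiv.sigmaCongrRight fun B : Sub R => B.subSubEquiv).symm

theorem flagEquiv_mk {R : NilRep k} (A B : Sub R) (h : A.1 ≤ B.1) :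
    flagEquiv R ⟨A, A.quotSubEquiv.symm ⟨B, h⟩⟩ = ⟨B, B.subSubEquiv.symm ⟨A, h⟩⟩ := by
  simp [flagEquiv, Equiv.sigmaCongrRight]

end NilRep

namespace HallAlgebra
open NilRep
variable {k : Type u} [Field k]

open Classical in
theorem coeff_one [Finite k] (M : NilRep k) :
    coeff M (1 : HallAlgebra k) = if M.dim = 0 then 1 else 0 := by
  refine (coeff_of M (semisimple k 0)).trans (if_congr ⟨fun h => ?_, fun h => ?_⟩ rfl rfl)
  · rw [dim_eq_of_cls_eq h, dim_semisimple]
  · exact cls_eq_of_dim_eq_zero h (dim_semisimple 0)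

variable [Finite k]

theorem hall_one_mul (f : HallAlgebra k) : 1 * f = f := by
  refine ext_coeff fun R => ?_
  classical
  simp only [coeff_mul, coeff_one, ← Sub.eq_top_iff, ite_mul, one_mul, zero_mul]
  rw [Finset.sum_ite_eq' _ (topSub R), if_pos (Finset.mem_univ _)]
  exact coeff_congr (cls_topSub_sub R) f

theorem hall_mul_one (f : HallAlgebra k) : f * 1 = f := by
  refine ext_coeff fun R => ?_
  classical
  simp only [coeff_mul, coeff_one, ← Sub.eq_bot_iff, mul_ite, mul_one, mul_zero]
  rw [Finset.sum_ite_eq' _ (botSub R), if_pos (Finset.mem_univ _)]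
  exact coeff_congr (cls_botSub_quot R) f

/-- Either bracketing sums `f(R/B) g(B/A) h(A)` over the flags `A ≤ B` in `R`. -/
theorem hall_mul_assoc (f g h : HallAlgebra k) : f * g * h = f * (g * h) := by
  classical
  refine ext_coeff fun R => ?_
  simp only [coeff_mul]
  simp only [Finset.sum_mul, Finset.mul_sum]
  rw [← Fintype.sum_sigma', ← Fintype.sum_sigma']
  refine Fintype.sum_equiv (flagEquiv R) _ _ ?_
  rintro ⟨A, Z⟩
  obtain ⟨⟨B, hAB⟩, rfl⟩ := A.quotSubEquiv.symm.surjective Z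
  rw [flagEquiv_mk, mul_assoc]
  have h1 := cls_quot_quot A (A.quotSubEquiv.symm ⟨B, hAB⟩)
  have h2 := cls_sub_sub B (B.subSubEquiv.symm ⟨A, hAB⟩)
  rw [Equiv.apply_symm_apply] at h1 h2
  rw [coeff_congr h1, coeff_congr (cls_quot_sub_eq_sub_quot A B hAB), coeff_congr h2]

end HallAlgebra
-- The socle, self-duality and commutativity
namespace NilRep

variable {k : Type u} [Field k]

/-- The subrepresentation `ker x`, the socle. -/
def socle (R : NilRep k) : Sub R := kerSub (p := R.x) (mem_hom_of_apply fun _ => rfl)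

theorem mem_socle {R : NilRep k} {v : R.V} : v ∈ R.socle.1 ↔ R.x v = 0 := Iff.rfl

/-- The extension of `M` by `k ^ r` in which `x` maps `m` to `x m` plus `φ m`. -/
def extendBy (M : NilRep k) {r : ℕ} (φ : M.V →ₗ[k] (Fin r → k)) : NilRep k where
  V := M.V × (Fin r → k)
  x := (M.x.prod φ) ∘ₗ LinearMap.fst k _ _
  nilpotent := by
    obtain ⟨n, hn⟩ := M.nilpotent
    refine ⟨n + 1, ?_⟩
    have h : ∀ (m : ℕ) (v : M.V × (Fin r → k)),
        ((((M.x.prod φ) ∘ₗ LinearMap.fst k _ _) ^ m) v).1 = (M.x ^ m) v.1 := by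
      intro m
      induction m with
      | zero => intro v; rfl
      | succ m ih => intro v; rw [pow_succ, Module.End.mul_apply, ih, pow_succ]; rfl
    refine LinearMap.ext fun v => ?_
    rw [pow_succ', Module.End.mul_apply, LinearMap.comp_apply, LinearMap.fst_apply, h, hn]
    simp

theorem extendBy_x (M : NilRep k) {r : ℕ} (φ : M.V →ₗ[k] (Fin r → k)) (v : M.V × (Fin r → k)) :
    (M.extendBy φ).x v = (M.x v.1, φ v.1) := rfl

/-- The projection of `M.extendBy φ` onto `M`. -/
def extendByProj (M : NilRep k) {r : ℕ} (φ : M.V →ₗ[k] (Fin r → k)) :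
    (M.extendBy φ).V →ₗ[k] M.V := LinearMap.fst k M.V (Fin r → k)

theorem extendByProj_mem (M : NilRep k) {r : ℕ} (φ : M.V →ₗ[k] (Fin r → k)) :
    M.extendByProj φ ∈ Hom (M.extendBy φ) M := mem_hom_of_apply fun _ => rfl

theorem extendByProj_surjective (M : NilRep k) {r : ℕ} (φ : M.V →ₗ[k] (Fin r → k)) :
    Function.Surjective (M.extendByProj φ) := LinearMap.fst_surjective

theorem dim_extendBy (M : NilRep k) {r : ℕ} (φ : M.V →ₗ[k] (Fin r → k)) :
    (M.extendBy φ).dim = M.dim + r := by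
  change Module.finrank k (M.V × (Fin r → k)) = _
  rw [Module.finrank_prod, Module.finrank_fin_fun]
  rfl

/-- The hypothesis says that `φ` is injective on `ker x`, so no socle arises beyond the added `k^r`.
-/
theorem ker_extendByProj (M : NilRep k) {r : ℕ} (φ : M.V →ₗ[k] (Fin r → k))
    (hφ : ∀ m, M.x m = 0 → φ m = 0 → m = 0) :
    LinearMap.ker (M.extendByProj φ) = (M.extendBy φ).socle.1 := by
  ext v
  change v.1 = 0 ↔ (M.x v.1, φ v.1) = 0
  rw [Prod.mk_eq_zero]
  exact ⟨fun h => by simp [h], fun h => hφ _ h.1 h.2⟩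

/-- A representation is an extension of its quotient by the socle. -/
theorem exists_iso_extendBy {M R : NilRep k} {p : R.V →ₗ[k] M.V} (hp : p ∈ Hom R M)
    (surj : Function.Surjective p) (hk : LinearMap.ker p = R.socle.1) {r : ℕ}
    (hr : R.socle.sub.dim = r) :
    ∃ φ : M.V →ₗ[k] (Fin r → k), (∀ m, M.x m = 0 → φ m = 0 → m = 0) ∧
      Nonempty (Iso R (M.extendBy φ)) := by
  -- Extend coordinates on the socle to `ρ` on all of `R`; then `(p, ρ)` is the isomorphism onto `M
  -- × k^r`. The cocycle is `ρ ∘ x` read through a section `σ` of `p`, where `x ∘ σ ∘ p = x` because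
  -- `ker p = ker x`.
  let s : R.socle.1 ≃ₗ[k] (Fin r → k) := LinearEquiv.ofFinrankEq _ _ (by
    rw [Module.finrank_fin_fun]; exact hr)
  obtain ⟨ρ, hρ⟩ := LinearMap.exists_extend s.toLinearMap
  have hρ' : ∀ v, R.x v = 0 → ρ v = 0 → v = 0 := by
    intro v hv h0
    have : s ⟨v, hv⟩ = 0 := (LinearMap.congr_fun hρ ⟨v, hv⟩).symm.trans h0
    exact congrArg Subtype.val ((LinearEquiv.map_eq_zero_iff s).1 this)
  have hkp : ∀ v, p v = 0 ↔ R.x v = 0 := fun v => by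
    rw [← LinearMap.mem_ker, hk]; rfl
  obtain ⟨σ, hσ⟩ := p.exists_rightInverse_of_surjective (LinearMap.range_eq_top.2 surj)
  have hσ' : ∀ v, R.x (σ (p v)) = R.x v := by
    intro v
    rw [← sub_eq_zero, ← map_sub, ← hkp, map_sub, sub_eq_zero]
    exact LinearMap.congr_fun hσ (p v)
  refine ⟨ρ ∘ₗ R.x ∘ₗ σ, ?_, ⟨⟨LinearEquiv.ofBijective (p.prod ρ) ?_, ?_⟩⟩⟩
  · intro m hm h0
    obtain ⟨v, rfl⟩ := surj m
    rw [hkp]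
    refine hρ' _ ?_ ?_
    · rw [← hkp, ← hom_apply hp, hm]
    · rw [← h0]
      exact congrArg ρ (hσ' v).symm
  · have inj : Function.Injective (p.prod ρ) := by
      rw [injective_iff_map_eq_zero]
      intro v hv
      obtain ⟨h1, h2⟩ := Prod.mk_eq_zero.1 hv
      exact hρ' v ((hkp v).1 h1) h2
    refine ⟨inj, ?_⟩
    refine (LinearMap.injective_iff_surjective_of_finrank_eq_finrank ?_).1 inj
    have h1 := p.finrank_range_add_finrank_ker
    rw [LinearMap.range_eq_top.2 surj, finrank_top, hk] at h1
    rw [Module.finrank_prod, Module.finrank_fin_fun, ← h1, ← hr]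
    rfl
  · refine mem_hom_of_apply fun v => ?_
    refine (extendBy_x M _ _).trans (Prod.ext (hom_apply hp v) ?_)
    exact congrArg ρ (hσ' v)

/-- All extensions of `M` by `k ^ r` in which `k ^ r` is the socle are isomorphic. -/
theorem nonempty_iso_extendBy (M : NilRep k) {r : ℕ} {φ ψ : M.V →ₗ[k] (Fin r → k)}
    (hφ : ∀ m, M.x m = 0 → φ m = 0 → m = 0) (hψ : ∀ m, M.x m = 0 → ψ m = 0 → m = 0) :
    Nonempty (Iso (M.extendBy φ) (M.extendBy ψ)) := by
  have inj : ∀ {χ : M.V →ₗ[k] (Fin r → k)}, (∀ m, M.x m = 0 → χ m = 0 → m = 0) →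
      Function.Injective (χ ∘ₗ M.socle.1.subtype) := by
    intro χ hχ
    rw [injective_iff_map_eq_zero]
    intro v hv
    exact Subtype.ext (hχ v.1 v.2 hv)
  -- `φ` and `ψ` both embed `ker x` in `k^r`, so some automorphism `g` of `k^r` carries one
  -- embedding to the other.
  obtain ⟨g, hg⟩ := Submodule.exists_linearEquiv_restrict_eq
    ((LinearEquiv.ofInjective _ (inj hφ)).symm.trans (LinearEquiv.ofInjective _ (inj hψ)))
  have hg' : ∀ m, M.x m = 0 → g (φ m) = ψ m := by
    intro m hm
    have := hg (LinearEquiv.ofInjective _ (inj hφ) ⟨m, hm⟩)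
    rw [LinearEquiv.trans_apply, LinearEquiv.symm_apply_apply] at this
    exact this.symm
  -- `ψ - g φ` vanishes on `ker x`, hence equals `θ x` for some `θ`; the shear `(m, v) ↦ (m, θ m + g
  -- v)` then intertwines the two extensions.
  have hker : LinearMap.ker M.x ≤ LinearMap.ker (ψ - g.toLinearMap ∘ₗ φ) := fun m hm => by
    rw [LinearMap.mem_ker] at hm ⊢
    exact sub_eq_zero.2 (hg' m hm).symm
  obtain ⟨θ, hθ⟩ : ∃ θ : M.V →ₗ[k] (Fin r → k), θ ∘ₗ M.x = ψ - g.toLinearMap ∘ₗ φ := by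
    obtain ⟨τ, hτ⟩ := M.x.rangeRestrict.exists_rightInverse_of_surjective
      (LinearMap.range_eq_top.2 M.x.surjective_rangeRestrict)
    obtain ⟨θ, hθ⟩ := LinearMap.exists_extend ((ψ - g.toLinearMap ∘ₗ φ) ∘ₗ τ)
    refine ⟨θ, LinearMap.ext fun m => ?_⟩
    have h1 : θ (M.x m) = (ψ - g.toLinearMap ∘ₗ φ) (τ (M.x.rangeRestrict m)) :=
      LinearMap.congr_fun hθ (M.x.rangeRestrict m)
    have h2 : M.x (τ (M.x.rangeRestrict m)) = M.x m :=
      congrArg Subtype.val (LinearMap.congr_fun hτ (M.x.rangeRestrict m))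
    rw [LinearMap.comp_apply, h1, ← sub_eq_zero, ← map_sub]
    refine hker ?_
    rw [LinearMap.mem_ker, map_sub, h2, sub_self]
  let L : M.V × (Fin r → k) →ₗ[k] M.V × (Fin r → k) :=
    (LinearMap.fst k _ _).prod (θ.coprod g.toLinearMap)
  have hL : ∀ v, L v = (v.1, θ v.1 + g v.2) := fun v => rfl
  have hinj : Function.Injective L := by
    rw [injective_iff_map_eq_zero]
    rintro ⟨m, v⟩ h
    rw [hL, Prod.mk_eq_zero] at h
    obtain ⟨rfl : m = 0, h⟩ := h
    simp only [map_zero, zero_add, LinearEquiv.map_eq_zero_iff] at h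
    rw [h]; rfl
  have hb : Function.Bijective L := ⟨hinj, LinearMap.injective_iff_surjective.1 hinj⟩
  refine ⟨⟨LinearEquiv.ofBijective (M := (M.extendBy φ).V) (M₂ := (M.extendBy ψ).V) L hb,
    mem_hom_of_apply fun (v : M.V × (Fin r → k)) => ?_⟩⟩
  change (M.x (L v).1, ψ (L v).1) = L (M.x v.1, φ v.1)
  rw [hL, hL]
  refine Prod.ext rfl ?_
  have := LinearMap.congr_fun hθ v.1
  simp only [LinearMap.comp_apply, LinearMap.sub_apply, LinearEquiv.coe_coe] at this
  simp [this]

/-- A representation is determined by its dimension and its quotient by the socle. -/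
theorem cls_eq_of_quot_socle {M R R' : NilRep k} {p : R.V →ₗ[k] M.V} (hp : p ∈ Hom R M)
    (surj : Function.Surjective p) (hk : LinearMap.ker p = R.socle.1)
    {p' : R'.V →ₗ[k] M.V} (hp' : p' ∈ Hom R' M)
    (surj' : Function.Surjective p') (hk' : LinearMap.ker p' = R'.socle.1)
    (hd : R.dim = R'.dim) : cls R = cls R' := by
  have h1 := R.socle.dim_add
  have h2 := R'.socle.dim_add
  rw [dim_eq_of_cls_eq (cls_quot_eq _ hp surj hk)] at h1
  rw [dim_eq_of_cls_eq (cls_quot_eq _ hp' surj' hk')] at h2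
  obtain ⟨φ, hφ, ⟨e⟩⟩ := exists_iso_extendBy hp surj hk rfl
  obtain ⟨ψ, hψ, ⟨f⟩⟩ := exists_iso_extendBy hp' surj' hk'
    (show R'.socle.sub.dim = R.socle.sub.dim by omega)
  obtain ⟨g⟩ := nonempty_iso_extendBy M hφ hψ
  exact (e.cls_eq.trans g.cls_eq).trans f.cls_eq.symm

theorem cls_eq_of_cls_quot_socle_eq {R R' : NilRep k} (h : cls R.socle.quot = cls R'.socle.quot)
    (hd : R.dim = R'.dim) : cls R = cls R' := by
  obtain ⟨e⟩ := cls_eq_iff.1 h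
  refine cls_eq_of_quot_socle (comp_mem_hom R.socle.proj_mem e.2)
    (e.1.surjective.comp R.socle.proj_surjective) ?_ R'.socle.proj_mem R'.socle.proj_surjective
    R'.socle.ker_proj hd
  rw [LinearEquiv.ker_comp, R.socle.ker_proj]

theorem dim_socle_ne_zero {R : NilRep k} (h : R.dim ≠ 0) : R.socle.sub.dim ≠ 0 := by
  intro h0
  have hb : LinearMap.ker R.x = ⊥ := Submodule.finrank_eq_zero.1 h0
  obtain ⟨n, hn⟩ := R.nilpotent
  have inj : Function.Injective (R.x ^ n) := by
    rw [Module.End.coe_pow]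
    exact (LinearMap.ker_eq_bot.1 hb).iterate n
  have : Subsingleton R.V := ⟨fun a b => inj (by rw [hn]; rfl)⟩
  exact h (Module.finrank_zero_of_subsingleton)

/-- The dual representation. -/
def dual (R : NilRep k) : NilRep k where
  V := Module.Dual k R.V
  x := R.x.dualMap
  nilpotent := by
    obtain ⟨n, hn⟩ := R.nilpotent
    refine ⟨n, ?_⟩
    have h : ∀ m : ℕ, R.x.dualMap ^ m = (R.x ^ m).dualMap := by
      intro m
      induction m with
      | zero => rfl
      | succ m ih => rw [pow_succ, ih, pow_succ']; rfl
    rw [h, hn]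
    exact LinearMap.ext fun f => LinearMap.ext fun _ => map_zero f

theorem dim_dual (R : NilRep k) : R.dual.dim = R.dim := Subspace.dual_finrank_eq

theorem dualMap_mem_hom {M N : NilRep k} {f : M.V →ₗ[k] N.V} (hf : f ∈ Hom M N) :
    f.dualMap ∈ Hom N.dual M.dual :=
  mem_hom_of_apply fun (v : Module.Dual k N.V) =>
    LinearMap.ext fun m => congrArg v (hom_apply hf m).symm

/-- The dual of an isomorphism. -/
def Iso.dual {M N : NilRep k} (e : Iso M N) : Iso N.dual M.dual :=
  ⟨e.1.dualMap, dualMap_mem_hom e.2⟩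

/-- Every nilpotent representation is isomorphic to its dual. -/
theorem cls_dual (R : NilRep k) : cls R.dual = cls R := by
  induction h : R.dim using Nat.strong_induction_on generalizing R with
  | _ n ih =>
  by_cases h0 : R.dim = 0
  · exact cls_eq_of_dim_eq_zero ((dim_dual R).trans h0) h0
  have hs := dim_socle_ne_zero h0
  have hd := R.socle.dim_add
  obtain ⟨e⟩ := cls_eq_iff.1 (ih _ (show R.socle.quot.dim < n by omega) R.socle.quot rfl)
  -- `x` induces an embedding `i : R / ker x → R`. Its transpose maps the dual of `R` onto the dual
  -- of `R / ker x`, which is `R / ker x` by induction, and its kernel is the socle of the dual. So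
  -- `R` and its dual have the same quotient by the socle.
  let i : R.socle.quot.V →ₗ[k] R.V := R.socle.1.liftQ R.x le_rfl
  have hi : i ∈ Hom R.socle.quot R := mem_hom_of_apply fun v => by
    obtain ⟨v, rfl⟩ := R.socle.proj_surjective v
    rfl
  have inj : Function.Injective i :=
    LinearMap.ker_eq_bot.1 (Submodule.ker_liftQ_eq_bot _ _ _ le_rfl)
  refine cls_eq_of_quot_socle (comp_mem_hom (dualMap_mem_hom hi) e.2)
    (e.1.surjective.comp (LinearMap.dualMap_surjective_of_injective inj)) ?_
    R.socle.proj_mem R.socle.proj_surjective R.socle.ker_proj (dim_dual R)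
  refine (LinearEquiv.ker_comp e.1 i.dualMap).trans ?_
  -- The dual endomorphism is the transpose of `i` followed by the transpose of the projection, and
  -- the latter is injective.
  ext f
  exact (map_eq_zero_iff _ (LinearMap.dualMap_injective_of_surjective
    R.socle.proj_surjective) : R.socle.proj.dualMap (i.dualMap f) = 0 ↔ i.dualMap f = 0).symm

/-- Annihilators of subrepresentations. -/
def annihilatorEquiv (R : NilRep k) : Sub R ≃ Sub R.dual where
  toFun W := ⟨W.1.dualAnnihilator, fun _ hf =>
    (Submodule.mem_dualAnnihilator _).2 fun w hw =>
      (Submodule.mem_dualAnnihilator _).1 hf _ (W.2 w hw)⟩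
  invFun Z := ⟨Submodule.dualCoannihilator (R := k) (M := R.V) Z.1, fun _ hv =>
    (Submodule.mem_dualCoannihilator _).2 fun f hf =>
      (Submodule.mem_dualCoannihilator _).1 hv _ (Z.2 f hf)⟩
  left_inv _ := Subtype.ext Subspace.dualAnnihilator_dualCoannihilator_eq
  right_inv Z := Subtype.ext <|
    let Z' : Submodule k (Module.Dual k R.V) := Z.1
    Subspace.dualCoannihilator_dualAnnihilator_eq (W := Z')

theorem annihilatorEquiv_coe {R : NilRep k} (W : Sub R) :
    (R.annihilatorEquiv W).1 = W.1.dualAnnihilator := rfl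

theorem cls_annihilator_sub {R : NilRep k} (W : Sub R) :
    cls (R.annihilatorEquiv W).sub = cls W.quot :=
  (cls_sub_eq _ (dualMap_mem_hom W.proj_mem)
    (LinearMap.dualMap_injective_of_surjective W.proj_surjective)
    ((W.1.range_dualMap_mkQ_eq).trans (annihilatorEquiv_coe W).symm)).trans (cls_dual _)

theorem cls_annihilator_quot {R : NilRep k} (W : Sub R) :
    cls (R.annihilatorEquiv W).quot = cls W.sub :=
  (cls_quot_eq _ (dualMap_mem_hom W.incl_mem)
    (LinearMap.dualMap_surjective_of_injective W.incl_injective)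
    ((LinearMap.ker_dualMap_eq_dualAnnihilator_range _).trans
      (congrArg Submodule.dualAnnihilator W.range_incl))).trans (cls_dual _)

end NilRep

namespace HallAlgebra
open NilRep
variable {k : Type u} [Field k] [Finite k]

/-- Evaluate one product at the dual of `R`; passing to annihilators swaps the two factors of each
summand. -/
theorem hall_mul_comm (f g : HallAlgebra k) : f * g = g * f := by
  refine ext_coeff fun R => ?_
  rw [← coeff_congr (cls_dual R) (g * f), coeff_mul, coeff_mul]
  refine Fintype.sum_equiv R.annihilatorEquiv _ _ fun W => ?_
  rw [coeff_congr (cls_annihilator_sub W), coeff_congr (cls_annihilator_quot W), mul_comm]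

theorem mulCoeff_comm (M N R : NilRep k) : mulCoeff M N R = mulCoeff N M R := by
  classical
  have h : ∀ M N : NilRep k, mulCoeff M N R = coeff R (of M * of N) := fun M N => by
    rw [mulCoeff_eq, coeff_mul]
    simp only [coeff_of]
  rw [h, h, hall_mul_comm]

/-- With trivial Euler form, this is `mulCoeff` times `a_M a_N / a_R`, a factor symmetric in `M` and
`N`. -/
theorem comulCoeff_comm (M N R : NilRep k) : comulCoeff M N R = comulCoeff N M R := by
  have hM : (autCard M : ℂ) ≠ 0 := Nat.cast_ne_zero.2 (autCard_ne_zero M)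
  have hN : (autCard N : ℂ) ≠ 0 := Nat.cast_ne_zero.2 (autCard_ne_zero N)
  have h := mulCoeff_comm M N R
  rw [mulCoeff, mulCoeff, euler_eq_one, euler_eq_one, one_mul, one_mul, mul_comm (autCard N : ℂ),
    div_left_inj' (mul_ne_zero hM hN)] at h
  rw [comulCoeff, comulCoeff, euler_eq_one, euler_eq_one, h]

theorem comul_comm (f : HallAlgebra k) :
    TensorProduct.comm ℂ (HallAlgebra k) (HallAlgebra k) (comul f) = comul f := by
  have key : (TensorProduct.comm ℂ (HallAlgebra k) (HallAlgebra k)).toLinearMap ∘ₗ comul =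
      comul := by
    refine (basis k).ext fun r => ?_
    rw [LinearMap.comp_apply, comul, Module.Basis.constr_basis, Finsupp.sum, map_sum]
    refine Finset.sum_equiv (Equiv.prodComm _ _) ?_ ?_
    · rintro ⟨c, d⟩
      simp only [Finsupp.mem_support_iff]
      change comulCoeff c.rep d.rep r.rep ≠ 0 ↔ comulCoeff d.rep c.rep r.rep ≠ 0
      rw [comulCoeff_comm]
    · rintro ⟨c, d⟩ _
      rw [map_smul]
      change comulCoeff c.rep d.rep r.rep • (basis k d ⊗ₜ[ℂ] basis k c) =
        comulCoeff d.rep c.rep r.rep • (basis k d ⊗ₜ[ℂ] basis k c)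
      rw [comulCoeff_comm]
  exact LinearMap.congr_fun key f

end HallAlgebra
-- The coproduct of `(k^n, 0)`
namespace NilRep

section Splitting

variable {k U V W : Type*} [Field k] [AddCommGroup U] [Module k U] [AddCommGroup V] [Module k V]
  [AddCommGroup W] [Module k W]

/-- Short exact sequences of vector spaces `0 → U → V → W → 0` with a splitting are counted by the
isomorphisms `U × W ≃ V`. -/
theorem card_exact_mul_card_linearMap :
    Nat.card {p : (U →ₗ[k] V) × (V →ₗ[k] W) // Function.Injective p.1 ∧ Function.Surjective p.2 ∧
      Function.Exact p.1 p.2} * Nat.card (W →ₗ[k] U) = Nat.card ((U × W) ≃ₗ[k] V) := by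
  classical
  -- The default `0` for non-surjective `b` only makes the choice of section total.
  have hsec : ∀ b : V →ₗ[k] W, ∃ σ : W →ₗ[k] V, Function.Surjective b → b ∘ₗ σ = LinearMap.id := by
    intro b
    by_cases hb : Function.Surjective b
    · obtain ⟨σ, hσ⟩ := b.exists_rightInverse_of_surjective (LinearMap.range_eq_top.2 hb)
      exact ⟨σ, fun _ => hσ⟩
    · exact ⟨0, fun h => absurd h hb⟩
  choose σ hσ using hsec
  -- The sections of `b` are exactly `σ b + a ∘ h` with `h : W → U`, so a sequence together with `h`
  -- is a split sequence, that is, an isomorphism `U × W ≃ V`.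
  let L : (U →ₗ[k] V) → (V →ₗ[k] W) → (W →ₗ[k] U) → (U × W) →ₗ[k] V := fun a b h =>
    a.coprod (σ b + a ∘ₗ h)
  have hL : ∀ a b h u w, L a b h (u, w) = a u + (σ b w + a (h w)) := fun _ _ _ _ _ => rfl
  have hbL : ∀ (a : U →ₗ[k] V) (b : V →ₗ[k] W) h, Function.Surjective b →
      Function.Exact a b → ∀ p, b (L a b h p) = p.2 := by
    rintro a b h hb hab ⟨u, w⟩
    rw [hL, map_add, map_add, hab.apply_apply_eq_zero, hab.apply_apply_eq_zero, zero_add, add_zero]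
    exact LinearMap.congr_fun (hσ b hb) w
  have bij : ∀ (a : U →ₗ[k] V) (b : V →ₗ[k] W) h, Function.Injective a →
      Function.Surjective b → Function.Exact a b → Function.Bijective (L a b h) := by
    intro a b h ha hb hab
    constructor
    · rw [injective_iff_map_eq_zero]
      rintro ⟨u, w⟩ h0
      obtain rfl : w = 0 := (hbL a b h hb hab (u, w)).symm.trans (by rw [h0, map_zero])
      rw [hL] at h0
      simp only [map_zero, add_zero] at h0
      rw [(map_eq_zero_iff a ha).1 h0]
      rfl
    · intro y
      obtain ⟨u, hu⟩ := (hab (y - L a b h (0, b y))).1 (by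
        rw [map_sub, hbL a b h hb hab, sub_self])
      refine ⟨(u, b y), ?_⟩
      rw [hL] at hu ⊢
      rw [hu]
      simp
  rw [← Nat.card_prod]
  refine Nat.card_eq_of_bijective (fun q => LinearEquiv.ofBijective (L q.1.1.1 q.1.1.2 q.2)
    (bij _ _ _ q.1.2.1 q.1.2.2.1 q.1.2.2.2)) ⟨?_, ?_⟩
  · rintro ⟨⟨⟨a, b⟩, ha, hb, hab⟩, h⟩ ⟨⟨⟨a', b'⟩, ha', hb', hab'⟩, h'⟩ heq
    have hLL : ∀ p, L a b h p = L a' b' h' p := fun p => LinearEquiv.congr_fun heq p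
    obtain rfl : a = a' := by
      ext u
      simpa [hL] using hLL (u, 0)
    obtain rfl : b = b' := by
      ext y
      obtain ⟨p, rfl⟩ := (bij a b h ha hb hab).2 y
      rw [hbL a b h hb hab, hLL, hbL a b' h' hb' hab']
    obtain rfl : h = h' := by
      ext w
      exact ha (by simpa [hL] using hLL (0, w))
    rfl
  · intro e
    have hb : Function.Surjective (LinearMap.snd k U W ∘ₗ e.symm.toLinearMap) :=
      (LinearMap.snd_surjective (R := k) (M := U) (M₂ := W)).comp e.symm.surjective
    -- The section given by `e` is `w ↦ e (0, w)`; this `h` is its difference from the chosen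
    -- section, in `U`-coordinates.
    refine ⟨⟨⟨(e.toLinearMap ∘ₗ LinearMap.inl k U W, LinearMap.snd k U W ∘ₗ e.symm.toLinearMap),
      e.injective.comp (LinearMap.inl_injective (R := k) (M := U) (M₂ := W)), hb, ?_⟩,
      -(LinearMap.fst k U W ∘ₗ e.symm.toLinearMap ∘ₗ
        σ (LinearMap.snd k U W ∘ₗ e.symm.toLinearMap))⟩, ?_⟩
    · intro y
      constructor
      · intro hy
        exact ⟨(e.symm y).1, by
          have : ((e.symm y).1, (0 : W)) = e.symm y := Prod.ext rfl hy.symm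
          simp [this]⟩
      · rintro ⟨u, rfl⟩
        simp
    · ext1 ⟨u, w⟩
      apply e.symm.injective
      have h2 : (e.symm (σ (LinearMap.snd k U W ∘ₗ e.symm.toLinearMap) w)).2 = w :=
        LinearMap.congr_fun (hσ _ hb) w
      rw [LinearEquiv.ofBijective_apply, hL]
      simp only [map_add, LinearEquiv.symm_apply_apply, LinearMap.comp_apply, LinearEquiv.coe_coe]
      ext <;> simp [h2]

end Splitting

variable {k : Type u} [Field k]

theorem autCard_congr {M N : NilRep k} (h : cls M = cls N) : autCard M = autCard N := by
  obtain ⟨e⟩ := cls_eq_iff.1 h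
  exact (card_iso_left e).symm.trans (card_iso_right e)

theorem cls_eq_semisimple {M : NilRep k} (h : M.x = 0) : cls M = cls (semisimple k M.dim) :=
  Iso.cls_eq ⟨(Module.finBasis k M.V).equivFun, mem_hom_of_apply fun v => by
    rw [h, LinearMap.zero_apply, map_zero]
    rfl⟩

theorem mem_hom_semisimple {m n : ℕ} (f : (Fin m → k) →ₗ[k] (Fin n → k)) :
    f ∈ Hom (semisimple k m) (semisimple k n) :=
  mem_hom_of_apply fun _ => (map_zero f).symm

theorem autCard_semisimple (n : ℕ) :
    autCard (semisimple k n) = Nat.card ((Fin n → k) ≃ₗ[k] (Fin n → k)) :=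
  Nat.card_congr (Equiv.subtypeUnivEquiv fun _ => mem_hom_semisimple _)

theorem cls_semisimple_injective : Function.Injective fun n => cls (semisimple k n) := by
  intro m n h
  simpa only [dim_semisimple] using dim_eq_of_cls_eq h

theorem sesCard_semisimple (r m : ℕ) :
    sesCard (semisimple k r) (semisimple k m) (semisimple k (m + r)) =
      Nat.card {p : ((Fin m → k) →ₗ[k] (Fin (m + r) → k)) × ((Fin (m + r) → k) →ₗ[k] (Fin r → k)) //
        Function.Injective p.1 ∧ Function.Surjective p.2 ∧ Function.Exact p.1 p.2} :=
  Nat.card_congr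
    { toFun := fun s => ⟨(s.1.1.1, s.1.2.1), s.2⟩
      invFun := fun s => ⟨(⟨s.1.1, mem_hom_semisimple _⟩, ⟨s.1.2, mem_hom_semisimple _⟩), s.2⟩
      left_inv := fun _ => rfl
      right_inv := fun _ => rfl }

theorem sesCard_semisimple_mul [Finite k] (r m : ℕ) :
    sesCard (semisimple k r) (semisimple k m) (semisimple k (m + r)) * Nat.card k ^ (r * m) =
      autCard (semisimple k (m + r)) := by
  have h : Nat.card ((Fin r → k) →ₗ[k] (Fin m → k)) = Nat.card k ^ (r * m) := by
    rw [Module.natCard_eq_pow_finrank (K := k), Module.finrank_linearMap, Module.finrank_fin_fun,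
      Module.finrank_fin_fun]
  have e : ((Fin m → k) × (Fin r → k)) ≃ₗ[k] (Fin (m + r) → k) := LinearEquiv.ofFinrankEq _ _ (by
    simp)
  rw [sesCard_semisimple, ← h, card_exact_mul_card_linearMap, autCard_semisimple]
  exact Nat.card_congr
    ⟨fun f => e.symm.trans f, fun f => e.trans f, fun f => by ext1; simp, fun f => by ext1; simp⟩

theorem cls_eq_semisimple_of_shortExact {M N : NilRep k} {n : ℕ}
    (s : ShortExact M N (semisimple k n)) :
    cls M = cls (semisimple k M.dim) ∧ cls N = cls (semisimple k N.dim) := by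
  obtain ⟨⟨⟨a, ha⟩, ⟨b, hb⟩⟩, inj, surj, -⟩ := s
  constructor
  · refine cls_eq_semisimple (LinearMap.ext fun v => ?_)
    obtain ⟨v, rfl⟩ := surj v
    rw [hom_apply hb]
    exact map_zero b
  · refine cls_eq_semisimple (LinearMap.ext fun v => inj ?_)
    exact (hom_apply ha v).symm.trans (map_zero a).symm

variable [Finite k]

theorem sesCard_congr_of_cls_eq {M M' N N' R R' : NilRep k} (hM : cls M = cls M')
    (hN : cls N = cls N') (hR : cls R = cls R') : sesCard M N R = sesCard M' N' R' := by
  obtain ⟨e⟩ := cls_eq_iff.1 hR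
  rw [sesCard_congr M N e, ← Nat.cast_inj (R := ℂ)]
  classical
  rw [sesCard_eq, sesCard_eq, hM, hN, autCard_congr hM, autCard_congr hN]

end NilRep

namespace HallAlgebra
open NilRep
variable {k : Type u} [Field k] [Finite k]

theorem comulCoeff_congr {M M' N N' R R' : NilRep k} (hM : cls M = cls M')
    (hN : cls N = cls N') (hR : cls R = cls R') : comulCoeff M N R = comulCoeff M' N' R' := by
  rw [comulCoeff, comulCoeff, euler_eq_one, euler_eq_one, sesCard_congr_of_cls_eq hM hN hR,
    autCard_congr hR]

theorem comulCoeff_semisimple {n r : ℕ} (h : r ≤ n) :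
    comulCoeff (semisimple k r) (semisimple k (n - r)) (semisimple k n) =
      (Nat.card k : ℂ) ^ (-((r : ℤ) * ((n : ℤ) - (r : ℤ)))) := by
  obtain ⟨m, rfl⟩ := Nat.exists_eq_add_of_le' h
  have hq : (Nat.card k : ℂ) ≠ 0 := Nat.cast_ne_zero.2 Nat.card_pos.ne'
  have ha : (autCard (semisimple k (m + r)) : ℂ) ≠ 0 := Nat.cast_ne_zero.2 (autCard_ne_zero _)
  rw [comulCoeff, euler_eq_one, one_mul, Nat.add_sub_cancel, div_eq_iff ha,
    ← sesCard_semisimple_mul]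
  have hz : (r : ℤ) * (((m + r : ℕ) : ℤ) - (r : ℤ)) = ((r * m : ℕ) : ℤ) := by
    push_cast; ring
  rw [hz, zpow_neg, zpow_natCast]
  push_cast
  field_simp

/-- Pairs outside the support contribute zero, so any convenient finite set containing it may index
the sum. -/
theorem comul_of (R : NilRep k) {s : Finset (IsoClass k × IsoClass k)}
    (hs : ∀ p : IsoClass k × IsoClass k, p ∉ s → comulCoeff p.1.rep p.2.rep R = 0) :
    comul (of R) = ∑ p ∈ s, comulCoeff p.1.rep p.2.rep R • (basis k p.1 ⊗ₜ[ℂ] basis k p.2) := by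
  have hc : ∀ p : IsoClass k × IsoClass k,
      comulCoeff p.1.rep p.2.rep (cls R).rep = comulCoeff p.1.rep p.2.rep R := fun p =>
    comulCoeff_congr rfl rfl (cls_rep _)
  rw [of, comul, Module.Basis.constr_basis]
  refine (Finset.sum_subset ?_ ?_).trans (Finset.sum_congr rfl fun p _ => ?_)
  · intro p hp
    by_contra h
    refine Finsupp.mem_support_iff.1 hp ?_
    exact (hc p).trans (hs p h)
  · intro p _ hp
    rw [Finsupp.notMem_support_iff.1 hp]
    exact zero_smul ℂ _
  · rw [← hc p]
    rfl

theorem comul_semisimple (n : ℕ) : comul (of (semisimple k n)) =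
    ∑ r ∈ Finset.range (n + 1), (Nat.card k : ℂ) ^ (-((r : ℤ) * ((n : ℤ) - (r : ℤ)))) •
      (of (semisimple k r) ⊗ₜ[ℂ] of (semisimple k (n - r))) := by
  classical
  rw [comul_of (semisimple k n) (s := (Finset.range (n + 1)).image fun r =>
    (cls (semisimple k r), cls (semisimple k (n - r)))), Finset.sum_image]
  · refine Finset.sum_congr rfl fun r hr => ?_
    rw [comulCoeff_congr (cls_rep _) (cls_rep _) rfl,
      comulCoeff_semisimple (Nat.lt_succ_iff.1 (Finset.mem_range.1 hr))]
    rfl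
  · intro r _ r' _ h
    exact cls_semisimple_injective (congrArg Prod.fst h)
  · rintro ⟨c, d⟩ hp
    by_contra h0
    refine hp ?_
    have h1 : sesCard c.rep d.rep (semisimple k n) ≠ 0 := fun h => h0 (by simp [comulCoeff, h])
    obtain ⟨s⟩ := (Nat.card_ne_zero.1 h1).1
    have hd := dim_add_of_shortExact s
    obtain ⟨hc, hd'⟩ := cls_eq_semisimple_of_shortExact s
    rw [cls_rep] at hc hd'
    rw [dim_semisimple] at hd
    refine Finset.mem_image.2 ⟨c.rep.dim, Finset.mem_range.2 (by omega), ?_⟩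
    rw [show n - c.rep.dim = d.rep.dim by omega, ← hc, ← hd']

end HallAlgebra
-- Socle types
namespace NilRep

variable {k : Type u} [Field k]

theorem dim_socle_le (R : NilRep k) : R.socle.sub.dim ≤ R.dim :=
  (Nat.le_add_left _ _).trans R.socle.dim_add.le

theorem dim_quot_socle_lt {R : NilRep k} (h : R.dim ≠ 0) : R.socle.quot.dim < R.dim := by
  have := R.socle.dim_add
  have := dim_socle_ne_zero h
  omega

/-- The type of a nilpotent representation, the conjugate of the partition given by the sizes of
the Jordan blocks: the multiset of the dimensions of the layers of its socle filtration. -/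
noncomputable def socleType (R : NilRep k) : ℕ+ →₀ ℕ :=
  open Classical in
  if h : R.dim = 0 then 0
  else socleType R.socle.quot +
    Finsupp.single ⟨R.socle.sub.dim, Nat.pos_of_ne_zero (dim_socle_ne_zero h)⟩ 1
termination_by R.dim
decreasing_by exact dim_quot_socle_lt h

theorem socleType_of_dim_eq_zero {R : NilRep k} (h : R.dim = 0) : socleType R = 0 := by
  rw [socleType, dif_pos h]

theorem socleType_eq {R : NilRep k} {n : ℕ+} (hn : R.socle.sub.dim = n) :
    socleType R = socleType R.socle.quot + Finsupp.single n 1 := by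
  have h : R.dim ≠ 0 := by
    have := R.dim_socle_le
    have := n.pos
    omega
  rw [socleType, dif_neg h]
  congr 2
  exact PNat.eq hn

theorem exists_pnat_dim_socle {R : NilRep k} (h : R.dim ≠ 0) : ∃ n : ℕ+, R.socle.sub.dim = n :=
  ⟨⟨_, Nat.pos_of_ne_zero (dim_socle_ne_zero h)⟩, rfl⟩

theorem cls_quot_socle_congr {R R' : NilRep k} (h : cls R = cls R') :
    cls R.socle.quot = cls R'.socle.quot := by
  obtain ⟨e⟩ := cls_eq_iff.1 h
  refine cls_quot_eq _ (comp_mem_hom e.2 R'.socle.proj_mem)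
    (R'.socle.proj_surjective.comp e.1.surjective) ?_
  ext v
  rw [LinearMap.ker_comp, R'.socle.ker_proj, Submodule.mem_comap, mem_socle, mem_socle,
    hom_apply e.2]
  exact LinearEquiv.map_eq_zero_iff e.1

theorem socleType_congr {R R' : NilRep k} (h : cls R = cls R') : socleType R = socleType R' := by
  induction hd : R.dim using Nat.strong_induction_on generalizing R R' with
  | _ n ih =>
  have hdd := dim_eq_of_cls_eq h
  by_cases h0 : R.dim = 0
  · rw [socleType_of_dim_eq_zero h0, socleType_of_dim_eq_zero (hdd.symm.trans h0)]
  have hq := cls_quot_socle_congr h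
  have hqd := dim_eq_of_cls_eq hq
  obtain ⟨m, hm⟩ := exists_pnat_dim_socle h0
  have h1 := R.socle.dim_add
  have h2 := R'.socle.dim_add
  rw [socleType_eq hm, socleType_eq (show R'.socle.sub.dim = m by omega),
    ih _ (hd ▸ dim_quot_socle_lt h0) hq rfl]

theorem weight_socleType (R : NilRep k) :
    Finsupp.weight (fun n : ℕ+ => (n : ℕ)) (socleType R) = R.dim := by
  induction hd : R.dim using Nat.strong_induction_on generalizing R with
  | _ n ih =>
  by_cases h0 : R.dim = 0
  · rw [socleType_of_dim_eq_zero h0, map_zero, ← hd, h0]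
  obtain ⟨m, hm⟩ := exists_pnat_dim_socle h0
  rw [socleType_eq hm, map_add, ih _ (hd ▸ dim_quot_socle_lt h0) _ rfl, Finsupp.weight_single,
    one_smul, ← hm, R.socle.dim_add, hd]

/-- Remove the largest part `m` and realise the rest by `M`. The socle dimension of `M` is zero or
one of the remaining parts, hence at most `m`; so `ker x` embeds in `k^m`, and extending `M` along
such an embedding adds a bottom layer of dimension `m`. -/
theorem exists_socleType_eq (s : ℕ+ →₀ ℕ) : ∃ R : NilRep k, socleType R = s := by
  induction hw : Finsupp.weight (fun n : ℕ+ => (n : ℕ)) s using Nat.strong_induction_on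
    generalizing s with
  | _ w ih =>
  by_cases h0 : s = 0
  · exact ⟨semisimple k 0, by rw [socleType_of_dim_eq_zero (dim_semisimple 0), h0]⟩
  have hne := Finsupp.support_nonempty_iff.2 h0
  obtain ⟨m, hm, hmax⟩ := s.support.exists_max_image id hne
  have hle : Finsupp.single m 1 ≤ s := by
    rw [Finsupp.single_le_iff]
    exact Nat.one_le_iff_ne_zero.2 (Finsupp.mem_support_iff.1 hm)
  obtain ⟨t, rfl⟩ := exists_add_of_le hle
  obtain ⟨M, rfl⟩ := ih (Finsupp.weight (fun n : ℕ+ => (n : ℕ)) t) (by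
    rw [← hw, map_add, Finsupp.weight_single, one_smul]
    have := m.pos
    omega) t rfl
  have hM : M.socle.sub.dim ≤ m := by
    by_cases hM0 : M.dim = 0
    · have := M.dim_socle_le
      omega
    · obtain ⟨l, hl⟩ := exists_pnat_dim_socle hM0
      rw [hl, PNat.coe_le_coe]
      refine hmax l (Finsupp.mem_support_iff.2 ?_)
      rw [socleType_eq hl, Finsupp.add_apply, Finsupp.add_apply, Finsupp.single_eq_same]
      omega
  let e : (M.socle.1 × (Fin (m - M.socle.sub.dim) → k)) ≃ₗ[k] (Fin m → k) :=
    LinearEquiv.ofFinrankEq _ _ (by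
      rw [Module.finrank_prod, Module.finrank_fin_fun, Module.finrank_fin_fun]
      exact Nat.add_sub_cancel' hM)
  obtain ⟨φ, hφ⟩ := LinearMap.exists_extend (e.toLinearMap ∘ₗ LinearMap.inl k _ _)
  have hφ' : ∀ v, M.x v = 0 → φ v = 0 → v = 0 := by
    intro v hv hv0
    have h1 : e (⟨v, hv⟩, 0) = 0 := (LinearMap.congr_fun hφ ⟨v, hv⟩).symm.trans hv0
    rw [LinearEquiv.map_eq_zero_iff, Prod.mk_eq_zero] at h1
    exact congrArg Subtype.val h1.1
  have hq := cls_quot_eq _ (M.extendByProj_mem φ) (M.extendByProj_surjective φ)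
    (M.ker_extendByProj φ hφ')
  have hd := (M.extendBy φ).socle.dim_add
  rw [dim_eq_of_cls_eq hq, dim_extendBy] at hd
  exact ⟨M.extendBy φ, by
    rw [socleType_eq (Nat.add_left_cancel hd), socleType_congr hq, add_comm]⟩

-- Bounds the number of monomials by the number of classes. Only surjectivity of the type is needed,
-- not that it separates classes.
variable (k) in
theorem weight_le_subset (n : ℕ) :
    {s : ℕ+ →₀ ℕ | Finsupp.weight (fun n : ℕ+ => (n : ℕ)) s ≤ n} ⊆
      (fun c : IsoClass k => socleType c.rep) '' {c : IsoClass k | c.rep.dim ≤ n} := by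
  intro s hs
  obtain ⟨R, rfl⟩ := exists_socleType_eq (k := k) s
  refine ⟨cls R, ?_, socleType_congr (cls_rep _)⟩
  rw [Set.mem_ofPred_eq, weight_socleType] at hs
  rwa [Set.mem_ofPred_eq, dim_rep_cls]

theorem cls_sub_socle (R : NilRep k) : cls R.socle.sub = cls (semisimple k R.socle.sub.dim) :=
  cls_eq_semisimple (LinearMap.ext fun v => Subtype.ext v.2)

theorem Sub.le_socle_of_cls_sub_eq {R : NilRep k} {W : Sub R} {r : ℕ}
    (h : cls W.sub = cls (semisimple k r)) : W.1 ≤ R.socle.1 := by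
  obtain ⟨e⟩ := cls_eq_iff.1 h
  intro v hv
  have h1 : e.1 (W.sub.x ⟨v, hv⟩) = 0 := (hom_apply e.2 ⟨v, hv⟩).symm
  exact congrArg W.incl ((LinearEquiv.map_eq_zero_iff e.1).1 h1)

theorem Sub.eq_socle {R : NilRep k} {W : Sub R} {r : ℕ}
    (h : cls W.sub = cls (semisimple k r)) (hr : R.socle.sub.dim ≤ r) : W = R.socle := by
  have hd : W.sub.dim = r := (dim_eq_of_cls_eq h).trans (dim_semisimple r)
  exact Subtype.ext (Submodule.eq_of_le_of_finrank_le (le_socle_of_cls_sub_eq h) (hr.trans hd.ge))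

end NilRep

/-! ### Polynomial generators -/

namespace HallAlgebra
open NilRep
variable {k : Type u} [Field k] [Finite k]

section Polynomial

/-- The Hall algebra as a commutative ring. -/
noncomputable abbrev commRing : CommRing (HallAlgebra k) :=
  { (inferInstance : AddCommGroup (HallAlgebra k)), (inferInstance : Mul (HallAlgebra k)),
    (inferInstance : One (HallAlgebra k)) with
    left_distrib := fun f g h => map_add (mulMap f) g h
    right_distrib := fun f g h => LinearMap.map_add₂ mulMap f g h
    zero_mul := fun f => LinearMap.map_zero₂ mulMap f
    mul_zero := fun f => map_zero (mulMap f)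
    mul_assoc := hall_mul_assoc
    one_mul := hall_one_mul
    mul_one := hall_mul_one
    mul_comm := hall_mul_comm }

attribute [local instance] commRing

/-- The algebra structure of the Hall algebra over `ℂ`. -/
noncomputable abbrev algebra : Algebra ℂ (HallAlgebra k) :=
  Algebra.ofModule (fun a f g => LinearMap.map_smul₂ mulMap a f g)
    (fun a f g => map_smul (mulMap f) a g)

attribute [local instance] algebra

/-- A subrepresentation killed by `x` lies in `ker x`, so by dimension only the socle contributes:
the leading coefficient is 1. -/
theorem coeff_quot_socle_mul_self (R : NilRep k) :
    coeff R (of R.socle.quot * of (semisimple k R.socle.sub.dim)) = 1 := by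
  classical
  simp only [coeff_mul, coeff_of]
  rw [Finset.sum_eq_single R.socle, if_pos rfl, if_pos (cls_sub_socle R), one_mul]
  · intro W _ hW
    rw [if_neg fun h => hW (W.eq_socle h le_rfl), mul_zero]
  · exact fun h => absurd (Finset.mem_univ _) h

/-- A contributing `W` lies in the socle of `R'`. If that socle were no larger, `W` would equal it,
and `R'` would share with `R` both dimension and quotient by the socle. -/
theorem lt_dim_socle_of_coeff_ne_zero {R R' : NilRep k}
    (h : coeff R' (of R.socle.quot * of (semisimple k R.socle.sub.dim)) ≠ 0)
    (hne : cls R' ≠ cls R) :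
    R'.dim = R.dim ∧ R.socle.sub.dim < R'.socle.sub.dim := by
  classical
  rw [coeff_mul] at h
  obtain ⟨W, -, hW⟩ := Finset.exists_ne_zero_of_sum_ne_zero h
  rw [coeff_of, coeff_of] at hW
  have h1 : cls W.quot = cls R.socle.quot := by
    by_contra h1
    exact hW (by rw [if_neg h1, zero_mul])
  have h2 : cls W.sub = cls (semisimple k R.socle.sub.dim) := by
    by_contra h2
    exact hW (by rw [if_neg h2, mul_zero])
  have hd : R'.dim = R.dim := by
    rw [← W.dim_add, ← R.socle.dim_add, dim_eq_of_cls_eq h1, dim_eq_of_cls_eq h2, dim_semisimple]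
  refine ⟨hd, not_le.1 fun hle => hne ?_⟩
  rw [W.eq_socle h2 hle] at h1
  exact cls_eq_of_cls_quot_socle_eq h1 hd

variable (k) in
/-- The algebra morphism from the polynomial ring which maps `X n` to the class of `(k ^ n, 0)`. -/
noncomputable def ofPolynomial : MvPolynomial ℕ+ ℂ →ₐ[ℂ] HallAlgebra k :=
  MvPolynomial.aeval fun n : ℕ+ => of (semisimple k n)

/-- The polynomials of weighted degree at most `n`. -/
noncomputable def weightLE (n : ℕ) : Submodule ℂ (MvPolynomial ℕ+ ℂ) :=
  Submodule.span ℂ ((fun s => MvPolynomial.monomial s 1) ''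
    {s : ℕ+ →₀ ℕ | Finsupp.weight (fun n : ℕ+ => (n : ℕ)) s ≤ n})

theorem mul_X_mem_weightLE {n : ℕ} {r : ℕ+} {p : MvPolynomial ℕ+ ℂ} (hp : p ∈ weightLE n) :
    p * MvPolynomial.X r ∈ weightLE (n + r) := by
  induction hp using Submodule.span_induction with
  | mem p hp =>
    obtain ⟨s, hs, rfl⟩ := hp
    refine Submodule.subset_span ⟨s + Finsupp.single r 1, ?_, ?_⟩
    · rw [Set.mem_ofPred_eq, map_add, Finsupp.weight_single, one_smul]
      exact Nat.add_le_add_right hs _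
    · simp [MvPolynomial.X, MvPolynomial.monomial_mul]
  | zero => rw [zero_mul]; exact Submodule.zero_mem _
  | add p q _ _ hp hq => rw [add_mul]; exact Submodule.add_mem _ hp hq
  | smul a p _ hp => rw [smul_mul_assoc]; exact Submodule.smul_mem _ a hp

theorem exists_mem_weightLE (p : MvPolynomial ℕ+ ℂ) : ∃ n, p ∈ weightLE n := by
  let w : (ℕ+ →₀ ℕ) → ℕ := Finsupp.weight fun n : ℕ+ => (n : ℕ)
  refine ⟨p.support.sup w, ?_⟩
  have h : ∑ s ∈ p.support, MvPolynomial.monomial s (p.coeff s) ∈ weightLE (p.support.sup w) := by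
    refine Submodule.sum_mem _ fun s hs => ?_
    rw [← mul_one (MvPolynomial.coeff s p), ← smul_eq_mul, ← MvPolynomial.smul_monomial]
    exact Submodule.smul_mem _ _ (Submodule.subset_span ⟨s, Finset.le_sup (f := w) hs, rfl⟩)
  rwa [p.support_sum_monomial_coeff] at h

theorem mem_of_forall_coeff_ne_zero {S : Submodule ℂ (HallAlgebra k)} {f : HallAlgebra k}
    (h : ∀ R : NilRep k, coeff R f ≠ 0 → of R ∈ S) : f ∈ S := by
  rw [← (basis k).linearCombination_repr f, Finsupp.linearCombination_apply, Finsupp.sum]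
  refine Submodule.sum_mem _ fun c hc => Submodule.smul_mem _ _ ?_
  rw [basis_eq_of]
  refine h _ ?_
  rw [coeff, cls_rep]
  exact Finsupp.mem_support_iff.1 hc

/-- Triangularity: the outer induction on the bound treats `R / ker x`, the inner one on `dim R -
dim ker x` treats the correction terms. -/
theorem of_mem_map_weightLE {n : ℕ} (R : NilRep k) (h : R.dim ≤ n) :
    of R ∈ (weightLE n).map (ofPolynomial k).toLinearMap := by
  induction n using Nat.strong_induction_on generalizing R with
  | _ n ih =>
  induction hj : R.dim - R.socle.sub.dim using Nat.strong_induction_on generalizing R with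
  | _ j ihj =>
  by_cases h0 : R.dim = 0
  · refine ⟨1, Submodule.subset_span ⟨0, ?_, rfl⟩, (map_one (ofPolynomial k)).trans ?_⟩
    · simp
    · exact congrArg (basis k) (cls_eq_of_dim_eq_zero (dim_semisimple 0) h0)
  obtain ⟨r, hr⟩ := exists_pnat_dim_socle h0
  have hd := R.socle.dim_add
  have hrpos := r.pos
  have hmul : of R.socle.quot * of (semisimple k R.socle.sub.dim) ∈
      (weightLE n).map (ofPolynomial k).toLinearMap := by
    obtain ⟨p, hp, hpq⟩ := ih (n - r) (by omega) R.socle.quot (by omega)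
    refine ⟨p * MvPolynomial.X r, ?_, ?_⟩
    · have := mul_X_mem_weightLE (r := r) hp
      rwa [Nat.sub_add_cancel (by omega)] at this
    · refine (map_mul (ofPolynomial k) p _).trans ?_
      rw [← hpq, hr]
      exact congrArg _ (MvPolynomial.aeval_X _ r)
  -- Product minus `[R]` involves only classes of the same dimension with larger socle.
  rw [← sub_sub_cancel (of R.socle.quot * of (semisimple k R.socle.sub.dim)) (of R)]
  refine Submodule.sub_mem _ hmul (mem_of_forall_coeff_ne_zero fun R' hR' => ?_)
  classical
  rw [map_sub, coeff_of] at hR'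
  by_cases hc : cls R' = cls R
  · rw [if_pos hc, coeff_congr hc, coeff_quot_socle_mul_self, sub_self] at hR'
    exact absurd rfl hR'
  · rw [if_neg hc, sub_zero] at hR'
    obtain ⟨hdim, hlt⟩ := lt_dim_socle_of_coeff_ne_zero hR' hc
    have := R'.dim_socle_le
    exact ihj (R'.dim - R'.socle.sub.dim) (by omega) R' (by omega) rfl

theorem ofPolynomial_surjective : Function.Surjective (ofPolynomial k) := by
  intro f
  have : f ∈ LinearMap.range (ofPolynomial k).toLinearMap :=
    mem_of_forall_coeff_ne_zero fun R _ =>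
      LinearMap.map_le_range (of_mem_map_weightLE R le_rfl)
  exact this

/-- In weight `≤ n` the source has dimension at most the number of classes of dimension `≤ n`, while
the image contains all these independent classes; rank-nullity leaves no kernel. -/
theorem ofPolynomial_injective : Function.Injective (ofPolynomial k) := by
  rw [injective_iff_map_eq_zero]
  intro p hp0
  obtain ⟨n, hp⟩ := exists_mem_weightLE p
  have hfin := finite_dim_le (k := k) n
  have hfin' := (hfin.image fun c : IsoClass k => socleType c.rep).subset (weight_le_subset k n)
  have : Module.Finite ℂ (weightLE n) := Module.Finite.span_of_finite ℂ (hfin'.image _)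
  have h1 : Module.finrank ℂ (weightLE n) ≤ {c : IsoClass k | c.rep.dim ≤ n}.ncard := by
    have := hfin'.image (fun s => MvPolynomial.monomial s (1 : ℂ)) |>.fintype
    refine (finrank_span_le_card _).trans ?_
    rw [← Set.ncard_eq_toFinset_card']
    refine (Set.ncard_image_le hfin').trans ?_
    exact (Set.ncard_le_ncard (weight_le_subset k n) (hfin.image _)).trans (Set.ncard_image_le hfin)
  have h2 : {c : IsoClass k | c.rep.dim ≤ n}.ncard ≤
      Module.finrank ℂ ((weightLE n).map (ofPolynomial k).toLinearMap) := by
    have := hfin.fintype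
    have hli : LinearIndependent ℂ fun c : {c : IsoClass k | c.rep.dim ≤ n} => basis k c :=
      (basis k).linearIndependent.comp _ Subtype.val_injective
    rw [← Nat.card_coe_set_eq, Nat.card_eq_fintype_card, ← finrank_span_eq_card hli]
    refine Submodule.finrank_mono (Submodule.span_le.2 ?_)
    rintro _ ⟨c, rfl⟩
    change basis k c.1 ∈ _
    rw [basis_eq_of]
    exact of_mem_map_weightLE _ c.2
  have h3 := ((ofPolynomial k).toLinearMap.domRestrict (weightLE n)).finrank_range_add_finrank_ker
  rw [LinearMap.range_domRestrict] at h3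
  have h4 : LinearMap.ker ((ofPolynomial k).toLinearMap.domRestrict (weightLE n)) = ⊥ :=
    Submodule.finrank_eq_zero.1 (by omega)
  have h5 : (⟨p, hp⟩ : weightLE n) = 0 := LinearMap.ker_eq_bot'.1 h4 _ hp0
  exact congrArg Subtype.val h5

variable (k) in
/-- The Hall algebra is the polynomial algebra in the classes of the `(k ^ n, 0)`, `1 ≤ n`. -/
theorem exists_linearEquiv_mvPolynomial : ∃ Φ : MvPolynomial ℕ+ ℂ ≃ₗ[ℂ] HallAlgebra k,
    Φ 1 = 1 ∧ (∀ p q, Φ (p * q) = Φ p * Φ q) ∧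
      ∀ n : ℕ+, Φ (MvPolynomial.X n) = of (semisimple k n) :=
  ⟨LinearEquiv.ofBijective (ofPolynomial k).toLinearMap
    ⟨ofPolynomial_injective, ofPolynomial_surjective⟩, map_one (ofPolynomial k),
    map_mul (ofPolynomial k), fun n => MvPolynomial.aeval_X _ n⟩

end Polynomial

end HallAlgebra

theorem theoremT (k : Type u) [Field k] [Finite k] :
    (∀ f g : HallAlgebra k, f * g = g * f) ∧
    (∀ f : HallAlgebra k,
      TensorProduct.comm ℂ (HallAlgebra k) (HallAlgebra k) (HallAlgebra.comul f) =
        HallAlgebra.comul f) ∧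
    (∃ Φ : MvPolynomial ℕ+ ℂ ≃ₗ[ℂ] HallAlgebra k,
      Φ 1 = 1 ∧ (∀ p q, Φ (p * q) = Φ p * Φ q) ∧
        ∀ n : ℕ+, Φ (MvPolynomial.X n) = HallAlgebra.of (NilRep.semisimple k n)) ∧
    (∀ n : ℕ, HallAlgebra.comul (HallAlgebra.of (NilRep.semisimple k n)) =
      ∑ r ∈ Finset.range (n + 1), (Nat.card k : ℂ) ^ (-((r : ℤ) * ((n : ℤ) - (r : ℤ)))) •
        (HallAlgebra.of (NilRep.semisimple k r) ⊗ₜ[ℂ]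
          HallAlgebra.of (NilRep.semisimple k (n - r)))) := by
  exact ⟨HallAlgebra.hall_mul_comm, HallAlgebra.comul_comm,
    HallAlgebra.exists_linearEquiv_mvPolynomial k, HallAlgebra.comul_semisimple⟩
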